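/- Let $0<I_1<I_2<I_3$ and $l>0$. Consider the sphere $p_1^2+p_2^2+p_3^2=2l$ in $\mathbb{R}^3$ with the symplectic form $$\omega=\frac{dp_1\wedge dp_2}{3p_3}=\frac{dp_2\wedge dp_3}{3p_1}=\frac{dp_3\wedge dp_1}{3p_2}$$ and the reduced Hamiltonian of the free rigid body $H=\frac12\left(\frac{p_1^2}{I_1}+\frac{p_2^2}{I_2}+\frac{p_3^2}{I_3}\right)$, and let $P_0$ be one of its two hyperbolic equilibria $(0,\pm\sqrt{2l},0)$. A Birkhoff normal form of $H$ at $P_0$ is a real function $\mathcal{H}$, analytic near $0$, such that $H=\mathcal{H}(XY)$ near $P_0$ for some real analytic local coordinates $(X,Y)$ on the sphere centred at $P_0$ with $\omega=dX\wedge dY$. Such a normal form exists, and one may take $\mathcal{H}'(0)>0$. Every normal form $\mathcal{H}$ at $P_0$ satisfies $\mathcal{H}(0)=l/I_2$ and $\mathcal{H}'(0)\neq 0$. If $\Phi_2$ is the local inverse of $\mathcal{H}$, defined near $l/I_2$ with $\Phi_2(l/I_2)=0$, and $\mathcal{H}'(0)>0$, then $\Phi_2$ is differentiable near $l/I_2$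 and, for all real $h$ sufficiently close to $l/I_2$, $$\Phi_2'(h)=\frac{\sqrt{-1}}{3\pi}\sqrt{\frac{2}{l}}\,\frac{1}{\sqrt{(d-c)(b-a)}}\,\mathcal{K}\!\left(\frac{(d-b)(a-c)}{(d-c)(a-b)}\right)=-\sqrt{-1}\,S(b,a,c,d),$$ where $a=\frac1{I_1}$, $b=\frac1{I_2}$, $c=\frac1{I_3}$, $d=\frac hl$, the square root of the negative number $(d-c)(b-a)$ is the principal one, $\sqrt{(d-c)(b-a)}=\sqrt{-1}\,\sqrt{(d-c)(a-b)}$, and $$\mathcal{K}(\lambda)=\int_0^1\frac{dx}{\sqrt{(1-x^2)(1-\lambda x^2)}},\qquad S(a,b,c,d)=-\frac{1}{3\pi}\sqrt{\frac 2l}\,\frac{1}{\sqrt{(d-c)(a-b)}}\,\mathcal{K}\!\left(\frac{(d-a)(b-c)}{(d-c)(b-a)}\right).$$ If instead $\mathcal{H}'(0)<0$, then $\Phi_2'(h)$ is the negative of this value (that is, the same formula with the other branch of $\sqrt{(d-c)(b-a)}$). -/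

import Mathlib

open scoped Matrix Topology

noncomputable section

namespace FreeRigidBody

/-- The Casimir function `L(P) = (p₁² + p₂² + p₃²) / 2` (half the squared angular momentum).
The coordinates `p₁, p₂, p₃` are `p 0, p 1, p 2`. -/
def casimir (p : Fin 3 → ℝ) : ℝ :=
  (p 0 ^ 2 + p 1 ^ 2 + p 2 ^ 2) / 2

/-- The Hamiltonian `H(P) = (p₁²/I₁ + p₂²/I₂ + p₃²/I₃) / 2` of the free rigid body with
inertia tensor `diag(I₁, I₂, I₃)`. -/
def hamiltonian (I₁ I₂ I₃ : ℝ) (p : Fin 3 → ℝ) : ℝ :=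
  (p 0 ^ 2 / I₁ + p 1 ^ 2 / I₂ + p 2 ^ 2 / I₃) / 2

/-- The symplectic form
`ω = dp₁ ∧ dp₂ / (3 p₃) = dp₂ ∧ dp₃ / (3 p₁) = dp₃ ∧ dp₁ / (3 p₂)`
on the spheres `L = l`, at the point `p`, evaluated on the vectors `v, w`. It is written as
`p · (v × w) / (3 |p|²)` in order to have one formula on the whole sphere; on tangent vectors
this agrees with each of the three expressions, see the three lemmas below. -/
def orbitForm (p v w : Fin 3 → ℝ) : ℝ :=
  (p ⬝ᵥ (v ⨯₃ w)) / (3 * (p ⬝ᵥ p))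

theorem orbitForm_eq_aux (p v w : Fin 3 → ℝ) (hv : p ⬝ᵥ v = 0) (hw : p ⬝ᵥ w = 0)
    (k : Fin 3) (hk : p k ≠ 0) :
    orbitForm p v w = (v ⨯₃ w) k / (3 * p k) := by
  have hpp : p ⬝ᵥ p ≠ 0 := by
    intro h
    rw [dotProduct_self_eq_zero] at h
    exact hk (by rw [h]; rfl)
  rw [orbitForm, div_eq_div_iff (by simpa using hpp) (by simpa using hk)]
  simp only [cross_apply, dotProduct, Fin.sum_univ_three] at *
  fin_cases k
  · simp
    linear_combination (3 * (p 1 * v 2 - p 2 * v 1)) * hw - (3 * (p 1 * w 2 - p 2 * w 1)) * hv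
  · simp
    linear_combination (3 * (p 2 * v 0 - p 0 * v 2)) * hw - (3 * (p 2 * w 0 - p 0 * w 2)) * hv
  · simp
    linear_combination (3 * (p 0 * v 1 - p 1 * v 0)) * hw - (3 * (p 0 * w 1 - p 1 * w 0)) * hv

/-- On the tangent plane, `ω = dp₁ ∧ dp₂ / (3 p₃)` where `p₃ ≠ 0`. -/
theorem orbitForm_eq_dp₁_dp₂ (p v w : Fin 3 → ℝ) (hv : p ⬝ᵥ v = 0) (hw : p ⬝ᵥ w = 0)
    (hp : p 2 ≠ 0) : orbitForm p v w = (v 0 * w 1 - v 1 * w 0) / (3 * p 2) := by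
  rw [orbitForm_eq_aux p v w hv hw 2 hp]; simp [cross_apply]

/-- On the tangent plane, `ω = dp₂ ∧ dp₃ / (3 p₁)` where `p₁ ≠ 0`. -/
theorem orbitForm_eq_dp₂_dp₃ (p v w : Fin 3 → ℝ) (hv : p ⬝ᵥ v = 0) (hw : p ⬝ᵥ w = 0)
    (hp : p 0 ≠ 0) : orbitForm p v w = (v 1 * w 2 - v 2 * w 1) / (3 * p 0) := by
  rw [orbitForm_eq_aux p v w hv hw 0 hp]; simp [cross_apply]

/-- On the tangent plane, `ω = dp₃ ∧ dp₁ / (3 p₂)` where `p₂ ≠ 0`. -/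
theorem orbitForm_eq_dp₃_dp₁ (p v w : Fin 3 → ℝ) (hv : p ⬝ᵥ v = 0) (hw : p ⬝ᵥ w = 0)
    (hp : p 1 ≠ 0) : orbitForm p v w = (v 2 * w 0 - v 0 * w 2) / (3 * p 1) := by
  rw [orbitForm_eq_aux p v w hv hw 1 hp]; simp [cross_apply]

/-- `ψ` is (the inverse of) a system of real analytic Darboux coordinates `(X, Y)`, centred at
`P₀`, on the sphere `L = l`: an analytic parametrization `(X, Y) ↦ ψ (X, Y)` of the sphere near
`ψ (0, 0) = P₀` with `ψ^* ω = dX ∧ dY`. (The last condition makes `ψ` an immersion at each point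
near the origin, hence a local analytic diffeomorphism onto the sphere.) -/
structure IsDarbouxParametrization (l : ℝ) (P₀ : Fin 3 → ℝ) (ψ : ℝ × ℝ → Fin 3 → ℝ) : Prop where
  analyticAt : AnalyticAt ℝ ψ 0
  map_zero : ψ 0 = P₀
  casimir_eq : ∀ᶠ z in 𝓝 (0 : ℝ × ℝ), casimir (ψ z) = l
  pullback_eq : ∀ᶠ z in 𝓝 (0 : ℝ × ℝ),
    orbitForm (ψ z) (fderiv ℝ ψ z (1, 0)) (fderiv ℝ ψ z (0, 1)) = 1

/-- `𝓗` is a (convergent) Birkhoff normal form, of hyperbolic type, of the reduced Hamiltonian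
`H|_{L = l}` at the point `P₀`: `𝓗` is real analytic near `0`, and `H = 𝓗(XY)` near `P₀` in
suitable real analytic Darboux coordinates `(X, Y)` centred at `P₀`. Here `H` is the energy itself,
so that `𝓗(0) = H(P₀)`. -/
def IsHyperbolicBirkhoffNormalForm (I₁ I₂ I₃ l : ℝ) (P₀ : Fin 3 → ℝ) (𝓗 : ℝ → ℝ) : Prop :=
  AnalyticAt ℝ 𝓗 0 ∧
    ∃ ψ : ℝ × ℝ → Fin 3 → ℝ, IsDarbouxParametrization l P₀ ψ ∧
      ∀ᶠ z in 𝓝 (0 : ℝ × ℝ), hamiltonian I₁ I₂ I₃ (ψ z) = 𝓗 (z.1 * z.2)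

/-- The complete elliptic integral of the first kind, as a function of the parameter `t`
(the square of the modulus), for real `t < 1`. -/
def ellipticK (t : ℝ) : ℝ :=
  ∫ x in (0 : ℝ)..1, 1 / √((1 - x ^ 2) * (1 - t * x ^ 2))

/-- The function
`S(a,b,c,d) = -(1/(3π)) √(2/l) ((d-c)(a-b))^(-1/2) K((d-a)(b-c) / ((d-c)(b-a)))`,
with the principal branch of the complex square root. -/
def S (l a b c d : ℝ) : ℂ :=
  -(1 / (3 * (Real.pi : ℂ))) * (√(2 / l) : ℝ) *
    (1 / Complex.sqrt (((d - c) * (a - b) : ℝ) : ℂ)) *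
    (ellipticK ((d - a) * (b - c) / ((d - c) * (b - a))) : ℝ)

end FreeRigidBody

end

/-!
Near `P₀` the sphere has linear coordinates `x, y` with `H - l / I₂ = x y`, in which `ω` becomes
`g dx ∧ dy`. Let `Z = x ∂/∂x - y ∂/∂y`. Since `Z` multiplies `x ^ j y ^ k` by `j - k`, one can write
`g = P (x y) + Z Ψ` with `P` and `Ψ` analytic, and `P s` is the mean of `g` over the vanishing
cycle `x y = s`, here a complete elliptic integral.

Existence: if `(s U)' = P` and `φ = Ψ / P (x y)`, then `X = x e ^ φ` and `Y = y U (x y) e ^ (-φ)`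
satisfy `X Y = x y U (x y)` and have Jacobian determinant `P (x y) (1 + Z φ) = g`.

Uniqueness: for any normalizing coordinates with `x y = E (X Y)`, integrating the same relation
along an arc of `X Y = s` across the saddle shows that `(P (E s) ∓ 1 / E' s) log s` extends
analytically to `s = 0`. Hence the factor vanishes, so that the inverse of `𝓗` has derivative
`± P (h - l / I₂)`.
-/

noncomputable section

namespace FreeRigidBody

open Filter Set
open scoped ContDiff
open Finset.HasAntidiagonal (antidiagonal mem_antidiagonal sigmaAntidiagonalEquivProd)

/-! ### Double power series -/

/-- The monomial `x ^ j * y ^ (n - j)`, for `j ≤ n`, as an `n`-linear map: the building block of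
the formal multilinear series of a double power series in `(x, y)`. -/
def monomialMap (n j : ℕ) : ContinuousMultilinearMap ℝ (fun _ : Fin n => ℝ × ℝ) ℝ :=
  (ContinuousMultilinearMap.mkPiAlgebra ℝ (Fin n) ℝ).compContinuousLinearMap
    fun i => if (i : ℕ) < j then ContinuousLinearMap.fst ℝ ℝ ℝ else ContinuousLinearMap.snd ℝ ℝ ℝ

theorem monomialMap_apply (j k : ℕ) (z : ℝ × ℝ) :
    monomialMap (j + k) j (fun _ => z) = z.1 ^ j * z.2 ^ k := by
  simp [monomialMap, Fin.prod_univ_add]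

theorem norm_monomialMap_le (n j : ℕ) : ‖monomialMap n j‖ ≤ 1 := by
  refine (ContinuousMultilinearMap.norm_compContinuousLinearMap_le _ _).trans ?_
  rw [ContinuousMultilinearMap.norm_mkPiAlgebra, one_mul]
  refine Finset.prod_le_one (fun _ _ => norm_nonneg _) fun i _ => ?_
  split_ifs
  · exact ContinuousLinearMap.norm_fst_le ..
  · exact ContinuousLinearMap.norm_snd_le ..

theorem eventually_abs_fst_le_and_abs_snd_le {r : ℝ} (hr : 0 < r) :
    ∀ᶠ z in 𝓝 (0 : ℝ × ℝ), |z.1| ≤ r ∧ |z.2| ≤ r := by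
  filter_upwards [Metric.closedBall_mem_nhds (0 : ℝ × ℝ) hr] with z hz
  simpa [Prod.norm_def] using hz

theorem abs_mul_monomial_le (c : ℝ) {x y r : ℝ} (hx : |x| ≤ r) (hy : |y| ≤ r) (j k : ℕ) :
    |c * (x ^ j * y ^ k)| ≤ |c| * r ^ (j + k) := by
  rw [abs_mul, abs_mul, abs_pow, abs_pow, pow_add]
  have hr : 0 ≤ r := (abs_nonneg x).trans hx
  gcongr

theorem analyticAt_tsum_monomial {a : ℕ × ℕ → ℝ} {r : ℝ} (hr : 0 < r)
    (ha : Summable fun p => |a p| * r ^ (p.1 + p.2)) :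
    AnalyticAt ℝ (fun z : ℝ × ℝ => ∑' p, a p * (z.1 ^ p.1 * z.2 ^ p.2)) 0 := by
  let q : FormalMultilinearSeries ℝ (ℝ × ℝ) ℝ := fun n =>
    ∑ p ∈ antidiagonal n, a p • monomialMap n p.1
  have hq_apply (n : ℕ) (z : ℝ × ℝ) :
      q n (fun _ => z) = ∑ p ∈ antidiagonal n, a p * (z.1 ^ p.1 * z.2 ^ p.2) := by
    simp only [q, sum_apply, smul_apply, smul_eq_mul]
    refine Finset.sum_congr rfl fun p hp => ?_
    obtain rfl := mem_antidiagonal.1 hp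
    rw [monomialMap_apply]
  have hq_norm (n : ℕ) : ‖q n‖ * r ^ n ≤ ∑' p, |a p| * r ^ (p.1 + p.2) :=
    calc ‖q n‖ * r ^ n ≤ (∑ p ∈ antidiagonal n, |a p|) * r ^ n := by
          gcongr
          refine (norm_sum_le _ _).trans (Finset.sum_le_sum fun p _ => ?_)
          rw [norm_smul, Real.norm_eq_abs]
          exact mul_le_of_le_one_right (abs_nonneg _) (norm_monomialMap_le n p.1)
      _ = ∑ p ∈ antidiagonal n, |a p| * r ^ (p.1 + p.2) := by
          rw [Finset.sum_mul]
          exact Finset.sum_congr rfl fun p hp => by rw [mem_antidiagonal.1 hp]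
      _ ≤ _ := ha.sum_le_tsum _ fun p _ => by positivity
  have hq_radius : 0 < q.radius :=
    (ENNReal.coe_pos.2 (show 0 < (⟨r, hr.le⟩ : NNReal) from hr)).trans_le
      (q.le_radius_of_bound _ hq_norm)
  refine (q.hasFPowerSeriesOnBall hq_radius).analyticAt.congr ?_
  filter_upwards [eventually_abs_fst_le_and_abs_snd_le hr] with z hz
  have hsum : Summable fun p : ℕ × ℕ => a p * (z.1 ^ p.1 * z.2 ^ p.2) :=
    ha.of_norm_bounded fun p => abs_mul_monomial_le (a p) hz.1 hz.2 p.1 p.2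
  have hregroup := (sigmaAntidiagonalEquivProd.hasSum_iff.2 hsum.hasSum).sigma fun n =>
    hasSum_fintype _
  refine Eq.trans (tsum_congr fun n => ?_) hregroup.tsum_eq
  rw [hq_apply, ← Finset.sum_coe_sort]
  rfl

theorem hasSum_pow_of_analyticAt {f : ℝ → ℝ} (hf : AnalyticAt ℝ f 0) :
    ∃ b : ℕ → ℝ, ∀ᶠ s in 𝓝 (0 : ℝ), HasSum (fun n => b n * s ^ n) (f s) := by
  obtain ⟨p, hp⟩ := hf
  refine ⟨p.coeff, ?_⟩
  simpa [mul_comm] using hasFPowerSeriesAt_iff'.1 hp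

theorem analyticAt_of_hasSum_pow {f : ℝ → ℝ} {b : ℕ → ℝ}
    (hf : ∀ᶠ s in 𝓝 (0 : ℝ), HasSum (fun n => b n * s ^ n) (f s)) : AnalyticAt ℝ f 0 := by
  refine ⟨FormalMultilinearSeries.ofScalars ℝ b, hasFPowerSeriesAt_iff'.2 ?_⟩
  simpa [mul_comm] using hf

theorem exists_summable_abs_mul_pow {b : ℕ → ℝ} {f : ℝ → ℝ}
    (hf : ∀ᶠ s in 𝓝 (0 : ℝ), HasSum (fun n => b n * s ^ n) (f s)) :
    ∃ r > 0, Summable fun n => |b n| * r ^ n := by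
  obtain ⟨r, hsum, hr⟩ :=
    ((hf.filter_mono nhdsWithin_le_nhds).and (self_mem_nhdsWithin (s := Ioi 0))).exists
  refine ⟨r, hr, ?_⟩
  simpa [abs_mul, abs_of_pos hr] using hsum.summable.abs

theorem exists_summable_abs_mul_pow_add {a : ℕ × ℕ → ℝ} {g : ℝ × ℝ → ℝ}
    (hg : ∀ᶠ z in 𝓝 (0 : ℝ × ℝ), HasSum (fun p => a p * (z.1 ^ p.1 * z.2 ^ p.2)) (g z)) :
    ∃ r > 0, Summable fun p => |a p| * r ^ (p.1 + p.2) := by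
  have hdiag : Tendsto (fun r : ℝ => (r, r)) (𝓝[>] 0) (𝓝 0) :=
    tendsto_nhdsWithin_of_tendsto_nhds (Continuous.tendsto' (by fun_prop) _ _ rfl)
  obtain ⟨r, hsum, hr⟩ := ((hdiag.eventually hg).and self_mem_nhdsWithin).exists
  refine ⟨r, hr, ?_⟩
  simpa [abs_mul, abs_of_pos (show 0 < r from hr), pow_add] using hsum.summable.abs

theorem abs_mul_exp_le {x t r : ℝ} (hx : |x| ≤ r / 3) (ht : t < 1) : |x * Real.exp t| ≤ r := by
  have hexp : Real.exp t ≤ 3 :=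
    (Real.exp_le_exp.2 ht.le).trans (Real.exp_one_lt_d9.le.trans (by norm_num))
  calc |x * Real.exp t| = |x| * Real.exp t := by rw [abs_mul, Real.abs_exp]
    _ ≤ r / 3 * 3 := by gcongr; exact (abs_nonneg x).trans hx
    _ = r := by ring

/-! ### The hyperbolic flow and its averages -/

/-- The flow of the vector field `x ∂/∂x - y ∂/∂y`, whose orbits are the hyperbolas
`x y = const`. -/
def hyperbolicFlow (t : ℝ) (z : ℝ × ℝ) : ℝ × ℝ := (z.1 * Real.exp t, z.2 * Real.exp (-t))

/-- The derivative `x ∂Ψ/∂x - y ∂Ψ/∂y` of `Ψ` along the vector field of `hyperbolicFlow`. -/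
def hyperbolicDeriv (Ψ : ℝ × ℝ → ℝ) (z : ℝ × ℝ) : ℝ := fderiv ℝ Ψ z (z.1, -z.2)

theorem hyperbolicFlow_zero (z : ℝ × ℝ) : hyperbolicFlow 0 z = z := by
  simp [hyperbolicFlow]

theorem hasDerivAt_hyperbolicFlow (t : ℝ) (z : ℝ × ℝ) :
    HasDerivAt (fun t => hyperbolicFlow t z)
      ((hyperbolicFlow t z).1, -(hyperbolicFlow t z).2) t := by
  simpa [hyperbolicFlow] using ((Real.hasDerivAt_exp t).const_mul z.1).prodMk
    ((hasDerivAt_neg t).exp.const_mul z.2)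

theorem hasDerivAt_comp_hyperbolicFlow {Ψ : ℝ × ℝ → ℝ} {t : ℝ} {z : ℝ × ℝ}
    (hΨ : DifferentiableAt ℝ Ψ (hyperbolicFlow t z)) :
    HasDerivAt (fun t => Ψ (hyperbolicFlow t z)) (hyperbolicDeriv Ψ (hyperbolicFlow t z)) t :=
  hΨ.hasFDerivAt.comp_hasDerivAt t (hasDerivAt_hyperbolicFlow t z)

theorem hyperbolicDeriv_eq_of_hasDerivAt {Ψ : ℝ × ℝ → ℝ} {z : ℝ × ℝ} {c : ℝ}
    (hΨ : DifferentiableAt ℝ Ψ z) (hc : HasDerivAt (fun t => Ψ (hyperbolicFlow t z)) c 0) :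
    hyperbolicDeriv Ψ z = c := by
  have hflow := hasDerivAt_comp_hyperbolicFlow (t := 0) (by rwa [hyperbolicFlow_zero])
  rw [hyperbolicFlow_zero] at hflow
  exact hflow.unique hc

theorem hasDerivAt_monomial_comp_hyperbolicFlow (j k : ℕ) (t : ℝ) (z : ℝ × ℝ) :
    HasDerivAt (fun t => (hyperbolicFlow t z).1 ^ j * (hyperbolicFlow t z).2 ^ k)
      ((j - k) * ((hyperbolicFlow t z).1 ^ j * (hyperbolicFlow t z).2 ^ k)) t := by
  have hmonomial (t : ℝ) : (hyperbolicFlow t z).1 ^ j * (hyperbolicFlow t z).2 ^ k =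
      z.1 ^ j * z.2 ^ k * Real.exp (t * (j - k)) := by
    rw [hyperbolicFlow, mul_pow, mul_pow, ← Real.exp_nat_mul, ← Real.exp_nat_mul,
      mul_mul_mul_comm, ← Real.exp_add]
    ring_nf
  simp only [hmonomial]
  exact ((hasDerivAt_mul_const ((j : ℝ) - k)).exp.const_mul (z.1 ^ j * z.2 ^ k)).congr_deriv
    (by ring)

theorem hyperbolicDeriv_tsum_monomial {a : ℕ × ℕ → ℝ} {r : ℝ}
    (ha : Summable fun p => |((p.1 : ℝ) - p.2) * a p| * r ^ (p.1 + p.2)) {z : ℝ × ℝ}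
    (hz₁ : |z.1| ≤ r / 3) (hz₂ : |z.2| ≤ r / 3)
    (hsum : Summable fun p => a p * (z.1 ^ p.1 * z.2 ^ p.2))
    (hdiff : DifferentiableAt ℝ (fun z : ℝ × ℝ => ∑' p, a p * (z.1 ^ p.1 * z.2 ^ p.2)) z) :
    hyperbolicDeriv (fun z : ℝ × ℝ => ∑' p, a p * (z.1 ^ p.1 * z.2 ^ p.2)) z =
      ∑' p : ℕ × ℕ, ((p.1 : ℝ) - p.2) * a p * (z.1 ^ p.1 * z.2 ^ p.2) := by
  have hderiv := hasDerivAt_tsum_of_isPreconnected (t := Ioo (-1 : ℝ) 1) (y₀ := 0) (y := 0)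
    (g := fun p t => a p * ((hyperbolicFlow t z).1 ^ p.1 * (hyperbolicFlow t z).2 ^ p.2))
    (g' := fun p t => ((p.1 : ℝ) - p.2) * a p *
      ((hyperbolicFlow t z).1 ^ p.1 * (hyperbolicFlow t z).2 ^ p.2))
    ha isOpen_Ioo isPreconnected_Ioo
    (fun p t _ =>
      ((hasDerivAt_monomial_comp_hyperbolicFlow p.1 p.2 t z).const_mul (a p)).congr_deriv (by ring))
    (fun p t ht => abs_mul_monomial_le _ (abs_mul_exp_le hz₁ ht.2)
      (abs_mul_exp_le hz₂ (neg_lt.1 ht.1)) p.1 p.2)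
    (by norm_num) (by simpa only [hyperbolicFlow_zero] using hsum) (by norm_num)
  refine hyperbolicDeriv_eq_of_hasDerivAt hdiff ?_
  simpa only [hyperbolicFlow_zero] using hderiv

theorem abs_div_natCast_sub_natCast_le (c : ℝ) (j k : ℕ) : |c / ((j : ℝ) - k)| ≤ |c| := by
  obtain rfl | h := eq_or_ne j k
  · simp
  · have hone : (1 : ℝ) ≤ |(j : ℝ) - k| := by
      exact_mod_cast Int.one_le_abs (sub_ne_zero.2 (Nat.cast_injective.ne h))
    rw [abs_div]
    exact div_le_self (abs_nonneg _) hone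

theorem exists_hasSum_sub_hyperbolicDeriv {a : ℕ × ℕ → ℝ} {g : ℝ × ℝ → ℝ}
    (hg : ∀ᶠ z in 𝓝 (0 : ℝ × ℝ), HasSum (fun p => a p * (z.1 ^ p.1 * z.2 ^ p.2)) (g z)) :
    ∃ Ψ : ℝ × ℝ → ℝ, AnalyticAt ℝ Ψ 0 ∧ ∀ᶠ z in 𝓝 (0 : ℝ × ℝ),
      HasSum (fun n => a (n, n) * (z.1 * z.2) ^ n) (g z - hyperbolicDeriv Ψ z) := by
  obtain ⟨r, hr, ha⟩ := exists_summable_abs_mul_pow_add hg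
  -- On the diagonal the quotient by `p.1 - p.2 = 0` is `0`, as wanted.
  let e : ℕ × ℕ → ℝ := fun p => a p / ((p.1 : ℝ) - p.2)
  have he_diag (n : ℕ) : ((n : ℝ) - n) * e (n, n) = 0 := by simp
  have he_off {p : ℕ × ℕ} (hp : p.1 ≠ p.2) : ((p.1 : ℝ) - p.2) * e p = a p :=
    mul_div_cancel₀ _ (sub_ne_zero.2 (Nat.cast_injective.ne hp))
  have hd_le (p : ℕ × ℕ) : |((p.1 : ℝ) - p.2) * e p| ≤ |a p| := by
    obtain h | h := eq_or_ne p.1 p.2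
    · simp [h]
    · rw [he_off h]
  have he : Summable fun p : ℕ × ℕ => |e p| * r ^ (p.1 + p.2) :=
    ha.of_nonneg_of_le (fun p => by positivity) fun p => by
      exact mul_le_mul_of_nonneg_right (abs_div_natCast_sub_natCast_le _ _ _) (by positivity)
  have hΨ := analyticAt_tsum_monomial hr he
  refine ⟨_, hΨ, ?_⟩
  have hd_summable : Summable fun p : ℕ × ℕ => |((p.1 : ℝ) - p.2) * e p| * r ^ (p.1 + p.2) :=
    ha.of_nonneg_of_le (fun p => by positivity) fun p => by
      exact mul_le_mul_of_nonneg_right (hd_le p) (by positivity)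
  filter_upwards [hg, hΨ.eventually_analyticAt,
    eventually_abs_fst_le_and_abs_snd_le (show 0 < r / 3 by positivity)] with z hgz hΨz ⟨hz₁, hz₂⟩
  have hz₁' : |z.1| ≤ r := hz₁.trans (by linarith)
  have hz₂' : |z.2| ≤ r := hz₂.trans (by linarith)
  rw [hyperbolicDeriv_tsum_monomial hd_summable hz₁ hz₂
    (he.of_norm_bounded fun p => abs_mul_monomial_le _ hz₁' hz₂' p.1 p.2) hΨz.differentiableAt]
  have hdiag := hgz.sub (hd_summable.of_norm_bounded fun p =>
    abs_mul_monomial_le _ hz₁' hz₂' p.1 p.2).hasSum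
  have hinj : Function.Injective fun n : ℕ => (n, n) := fun _ _ h => (Prod.ext_iff.1 h).1
  have hoff (p : ℕ × ℕ) (hp : p ∉ range fun n => (n, n)) :
      a p * (z.1 ^ p.1 * z.2 ^ p.2) - (p.1 - p.2) * e p * (z.1 ^ p.1 * z.2 ^ p.2) = 0 := by
    rw [he_off fun h => hp ⟨p.1, Prod.ext rfl h⟩, sub_self]
  convert (hinj.hasSum_iff hoff).2 hdiag using 2 with n
  simp only [Function.comp_apply, he_diag, zero_mul, sub_zero, mul_pow]

theorem hasSum_choose_mul_monomial {b : ℕ → ℝ} {u v : ℝ}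
    (hb : Summable fun n => |b n| * (|u| + |v|) ^ n) :
    HasSum (fun p : ℕ × ℕ => b (p.1 + p.2) * (p.1 + p.2).choose p.1 * (u ^ p.1 * v ^ p.2))
      (∑' n, b n * (u + v) ^ n) := by
  have hinner (b : ℕ → ℝ) (u v : ℝ) (n : ℕ) : HasSum
      (fun p : antidiagonal n => b (p.1.1 + p.1.2) * (p.1.1 + p.1.2).choose p.1.1 *
        (u ^ p.1.1 * v ^ p.1.2)) (b n * (u + v) ^ n) := by
    have hexpand : b n * (u + v) ^ n = ∑ p ∈ antidiagonal n,
        b (p.1 + p.2) * (p.1 + p.2).choose p.1 * (u ^ p.1 * v ^ p.2) := by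
      rw [(Commute.all u v).add_pow', Finset.mul_sum]
      refine Finset.sum_congr rfl fun p hp => ?_
      rw [mem_antidiagonal.1 hp, nsmul_eq_mul, mul_assoc]
    rw [hexpand]
    exact (antidiagonal n).hasSum _
  have hsum : Summable fun p : ℕ × ℕ =>
      b (p.1 + p.2) * (p.1 + p.2).choose p.1 * (u ^ p.1 * v ^ p.2) := by
    refine .of_abs (sigmaAntidiagonalEquivProd.summable_iff.1 ?_)
    refine (summable_sigma_of_nonneg fun _ => abs_nonneg _).2 ⟨fun _ => .of_finite, ?_⟩
    convert! hb with n
    rw [← (hinner (fun n => |b n|) |u| |v| n).tsum_eq]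
    exact tsum_congr fun p => by
      simp [Finset.HasAntidiagonal.sigmaAntidiagonalEquivProd, abs_mul]
  have hsigma := (sigmaAntidiagonalEquivProd.hasSum_iff.2 hsum.hasSum).sigma (hinner b u v)
  rw [hsigma.tsum_eq]
  exact hsum.hasSum

theorem eventually_hasSum_choose_mul_monomial {f : ℝ → ℝ} {b : ℕ → ℝ}
    (hf : ∀ᶠ s in 𝓝 (0 : ℝ), HasSum (fun n => b n * s ^ n) (f s)) :
    ∀ᶠ z in 𝓝 (0 : ℝ × ℝ),
      HasSum (fun p : ℕ × ℕ => b (p.1 + p.2) * (p.1 + p.2).choose p.1 *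
        (z.1 ^ p.1 * z.2 ^ p.2)) (f (z.1 + z.2)) := by
  obtain ⟨r, hr, hb⟩ := exists_summable_abs_mul_pow hf
  have hadd : Tendsto (fun z : ℝ × ℝ => z.1 + z.2) (𝓝 0) (𝓝 0) :=
    Continuous.tendsto' (by fun_prop) _ _ (by simp)
  filter_upwards [hadd.eventually hf, eventually_abs_fst_le_and_abs_snd_le (half_pos hr)]
    with z hz hzr
  rw [← hz.tsum_eq]
  refine hasSum_choose_mul_monomial (hb.of_nonneg_of_le (fun n => by positivity) fun n => ?_)
  gcongr
  linarith

theorem integral_two_mul_cos_pow_even (n : ℕ) :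
    ∫ θ in (0 : ℝ)..Real.pi, (2 * Real.cos θ) ^ (2 * n) = Real.pi * n.centralBinom := by
  induction n with
  | zero => simp
  | succ n ih =>
    have hcentralBinom : ((n : ℝ) + 1) * (n + 1).centralBinom =
        2 * (2 * n + 1) * n.centralBinom := by
      exact_mod_cast Nat.succ_mul_centralBinom_succ n
    simp only [mul_pow, intervalIntegral.integral_const_mul] at ih ⊢
    rw [Nat.mul_succ, integral_cos_pow, Real.sin_pi, Real.sin_zero]
    push_cast
    field_simp
    linear_combination 4 * (2 * n + 1) * ih - 2 * Real.pi * hcentralBinom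

theorem integral_two_mul_cos_pow_odd (n : ℕ) :
    ∫ θ in (0 : ℝ)..Real.pi, (2 * Real.cos θ) ^ (2 * n + 1) = 0 := by
  simpa [mul_pow] using integral_sin_pow_mul_cos_pow_odd (a := 0) (b := Real.pi) 0 n

theorem hasSum_integral_comp_mul {f k : ℝ → ℝ} {b : ℕ → ℝ}
    (hf : ∀ᶠ s in 𝓝 (0 : ℝ), HasSum (fun n => b n * s ^ n) (f s)) (hk : Continuous k)
    (u v : ℝ) :
    ∀ᶠ s in 𝓝 (0 : ℝ), HasSum (fun n => (b n * ∫ θ in u..v, k θ ^ n) * s ^ n)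
      (∫ θ in u..v, f (s * k θ)) := by
  obtain ⟨M, hM⟩ := isCompact_uIcc.exists_bound_of_continuousOn hk.continuousOn (s := uIcc u v)
  obtain ⟨r, hr, hb⟩ := exists_summable_abs_mul_pow hf
  obtain ⟨ε, hε, hf⟩ := Metric.eventually_nhds_iff.1 hf
  have hsmall : ∀ᶠ s : ℝ in 𝓝 0, |s| * M < min r ε := by
    have hcont : Continuous fun s : ℝ => |s| * M := by fun_prop
    exact hcont.continuousAt.eventually_lt_const (by simpa using ⟨hr, hε⟩)
  filter_upwards [hsmall] with s hs
  have hle {θ : ℝ} (hθ : θ ∈ uIoc u v) : |s * k θ| ≤ |s| * M := by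
    rw [abs_mul]
    exact mul_le_mul_of_nonneg_left (hM θ (uIoc_subset_uIcc hθ)) (abs_nonneg s)
  have hintegral := intervalIntegral.hasSum_integral_of_dominated_convergence
    (μ := MeasureTheory.volume) (a := u) (b := v)
    (F := fun (n : ℕ) θ => b n * (s * k θ) ^ n) (fun n _ => |b n| * r ^ n)
    (fun n => (by fun_prop : Continuous _).aestronglyMeasurable)
    (fun n => .of_forall fun θ hθ => by
      rw [Real.norm_eq_abs, abs_mul, abs_pow]
      gcongr
      exact (hle hθ).trans (hs.le.trans (min_le_left _ _)))
    (.of_forall fun θ _ => hb) (by simp)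
    (.of_forall fun θ hθ => hf (by
      rw [Real.dist_0_eq_abs]
      exact (hle hθ).trans_lt (hs.trans_le (min_le_right _ _))))
  simpa only [mul_pow, ← mul_assoc, intervalIntegral.integral_const_mul, mul_right_comm]
    using hintegral

theorem analyticAt_integral_comp_mul {f k : ℝ → ℝ} (hf : AnalyticAt ℝ f 0) (hk : Continuous k)
    (u v : ℝ) : AnalyticAt ℝ (fun s => ∫ θ in u..v, f (s * k θ)) 0 := by
  obtain ⟨b, hb⟩ := hasSum_pow_of_analyticAt hf
  exact analyticAt_of_hasSum_pow (hasSum_integral_comp_mul hb hk u v)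

/-- The average of `θ ↦ f (2 s cos θ)` over a period: the mean of `f (u + v)` over the vanishing
cycle `u = s e^{iθ}`, `v = s e^{-iθ}` of the hyperbola `u v = s ^ 2`. -/
def cosAverage (f : ℝ → ℝ) (s : ℝ) : ℝ :=
  1 / Real.pi * ∫ θ in (0 : ℝ)..Real.pi, f (s * (2 * Real.cos θ))

theorem hasSum_cosAverage {f : ℝ → ℝ} {b : ℕ → ℝ}
    (hf : ∀ᶠ s in 𝓝 (0 : ℝ), HasSum (fun n => b n * s ^ n) (f s)) :
    ∀ᶠ s in 𝓝 (0 : ℝ), HasSum (fun n => b (2 * n) * n.centralBinom * s ^ (2 * n))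
      (cosAverage f s) := by
  filter_upwards [hasSum_integral_comp_mul hf (k := fun θ => 2 * Real.cos θ) (by fun_prop) 0
    Real.pi] with s hs
  rw [cosAverage]
  have hinj : Function.Injective fun n : ℕ => 2 * n := fun _ _ h => by simpa using h
  have heven := (hinj.hasSum_iff fun n hn => ?_).2 hs
  · convert! heven.mul_left (1 / Real.pi) using 2 with n
    rw [Function.comp_apply, integral_two_mul_cos_pow_even]
    field_simp
  · obtain ⟨k, rfl | rfl⟩ := n.even_or_odd'
    · exact absurd ⟨k, rfl⟩ hn
    · rw [integral_two_mul_cos_pow_odd, mul_zero, zero_mul]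

theorem analyticAt_cosAverage {f : ℝ → ℝ} (hf : AnalyticAt ℝ f 0) :
    AnalyticAt ℝ (cosAverage f) 0 :=
  analyticAt_const.mul (analyticAt_integral_comp_mul hf (by fun_prop) 0 Real.pi)

/-- `P` is the average of `g` along the hyperbolic flow: `g` differs from the flow-invariant
function `(x, y) ↦ P (x y)` by a derivative along the flow. -/
def IsHyperbolicAverage (g : ℝ × ℝ → ℝ) (P : ℝ → ℝ) : Prop :=
  AnalyticAt ℝ P 0 ∧ ∃ Ψ : ℝ × ℝ → ℝ, AnalyticAt ℝ Ψ 0 ∧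
    ∀ᶠ z in 𝓝 (0 : ℝ × ℝ), g z = P (z.1 * z.2) + hyperbolicDeriv Ψ z

theorem tendsto_fst_mul_snd : Tendsto (fun z : ℝ × ℝ => z.1 * z.2) (𝓝 0) (𝓝 0) := by
  have hcont : Continuous fun z : ℝ × ℝ => z.1 * z.2 := by fun_prop
  simpa using hcont.tendsto 0

theorem IsHyperbolicAverage.congr {g g' : ℝ × ℝ → ℝ} {P P' : ℝ → ℝ}
    (h : IsHyperbolicAverage g P) (hg : g =ᶠ[𝓝 0] g') (hP : P =ᶠ[𝓝 0] P') :
    IsHyperbolicAverage g' P' := by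
  obtain ⟨hP_analytic, Ψ, hΨ, hgP⟩ := h
  refine ⟨hP_analytic.congr hP, Ψ, hΨ, ?_⟩
  filter_upwards [hgP, hg, tendsto_fst_mul_snd.eventually hP] with z hz hgz hPz
  rw [← hgz, hz, hPz]

theorem exists_comp_add_eq_cosAverage_add {f : ℝ → ℝ} (hf : AnalyticAt ℝ f 0) :
    ∃ Θ : ℝ × ℝ → ℝ, AnalyticAt ℝ Θ 0 ∧ ∀ᶠ z in 𝓝 (0 : ℝ × ℝ), ∀ s : ℝ, s ^ 2 = z.1 * z.2 →
      f (z.1 + z.2) = cosAverage f s + hyperbolicDeriv Θ z := by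
  obtain ⟨b, hb⟩ := hasSum_pow_of_analyticAt hf
  obtain ⟨Θ, hΘ, hsum⟩ :=
    exists_hasSum_sub_hyperbolicDeriv (eventually_hasSum_choose_mul_monomial hb)
  obtain ⟨ε, hε, haverage⟩ := Metric.eventually_nhds_iff.1 (hasSum_cosAverage hb)
  have hsmall : ∀ᶠ z : ℝ × ℝ in 𝓝 0, z.1 * z.2 < ε ^ 2 :=
    (continuous_fst.mul continuous_snd).continuousAt.eventually_lt_const
      (by simpa using pow_pos hε 2)
  refine ⟨Θ, hΘ, ?_⟩
  filter_upwards [hsum, hsmall] with z hz hzε s hs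
  have hsε : dist s 0 < ε := by
    rw [Real.dist_0_eq_abs]
    exact abs_lt_of_sq_lt_sq (hs.trans_lt hzε) hε.le
  rw [← sub_eq_iff_eq_add]
  refine hz.unique ?_
  convert! haverage hsε using 2 with n
  rw [← hs, ← pow_mul, ← two_mul, Nat.centralBinom]

theorem hyperbolicFlow_fst_mul_snd (t : ℝ) (z : ℝ × ℝ) :
    (hyperbolicFlow t z).1 * (hyperbolicFlow t z).2 = z.1 * z.2 := by
  rw [hyperbolicFlow, mul_mul_mul_comm, ← Real.exp_add, add_neg_cancel, Real.exp_zero, mul_one]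

theorem hyperbolicDeriv_comp_sq {Θ : ℝ × ℝ → ℝ} {κ ρ : ℝ → ℝ} {z : ℝ × ℝ}
    (hΘ : DifferentiableAt ℝ Θ (ρ (z.1 * z.2) * z.1 ^ 2, ρ (z.1 * z.2) * z.2 ^ 2))
    (hκ : DifferentiableAt ℝ κ (z.1 * z.2)) (hρ : DifferentiableAt ℝ ρ (z.1 * z.2)) :
    hyperbolicDeriv (fun z => 1 / 2 * κ (z.1 * z.2) *
        Θ (ρ (z.1 * z.2) * z.1 ^ 2, ρ (z.1 * z.2) * z.2 ^ 2)) z =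
      κ (z.1 * z.2) * hyperbolicDeriv Θ (ρ (z.1 * z.2) * z.1 ^ 2, ρ (z.1 * z.2) * z.2 ^ 2) := by
  have hz : DifferentiableAt ℝ (fun z : ℝ × ℝ => z.1 * z.2) z := by fun_prop
  refine hyperbolicDeriv_eq_of_hasDerivAt ?_ ?_
  · have hκz : DifferentiableAt ℝ (fun z : ℝ × ℝ => κ (z.1 * z.2)) z := hκ.comp z hz
    have hρz : DifferentiableAt ℝ (fun z : ℝ × ℝ => ρ (z.1 * z.2)) z := hρ.comp z hz
    exact (hκz.const_mul (1 / 2)).mul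
      (hΘ.comp z ((hρz.mul (by fun_prop)).prodMk (hρz.mul (by fun_prop))))
  set w : ℝ × ℝ := (ρ (z.1 * z.2) * z.1 ^ 2, ρ (z.1 * z.2) * z.2 ^ 2) with hw
  have hflow (t : ℝ) : (ρ (z.1 * z.2) * (hyperbolicFlow t z).1 ^ 2,
      ρ (z.1 * z.2) * (hyperbolicFlow t z).2 ^ 2) = hyperbolicFlow (2 * t) w := by
    simp only [hyperbolicFlow, hw, mul_pow, ← Real.exp_nat_mul, mul_assoc]
    norm_num
  simp only [hyperbolicFlow_fst_mul_snd, hflow]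
  have hderiv := hasDerivAt_comp_hyperbolicFlow (Ψ := Θ) (t := 2 * 0) (z := w)
    (by rwa [mul_zero, hyperbolicFlow_zero])
  convert! (hderiv.comp 0 (hasDerivAt_const_mul (2 : ℝ))).const_mul (1 / 2 * κ (z.1 * z.2))
    using 1
  rw [mul_zero, hyperbolicFlow_zero]
  ring

theorem isHyperbolicAverage_mul_comp {κ ρ f : ℝ → ℝ} (hκ : AnalyticAt ℝ κ 0)
    (hρ : AnalyticAt ℝ ρ 0) (hf : AnalyticAt ℝ f 0) :
    IsHyperbolicAverage
      (fun z => κ (z.1 * z.2) * f (ρ (z.1 * z.2) * (z.1 ^ 2 + z.2 ^ 2)))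
      (fun s => κ s * cosAverage f (ρ s * s)) := by
  obtain ⟨Θ, hΘ, hΘ_eq⟩ := exists_comp_add_eq_cosAverage_add hf
  have hmul : AnalyticAt ℝ (fun z : ℝ × ℝ => z.1 * z.2) 0 := analyticAt_fst.mul analyticAt_snd
  have hκ_mul : AnalyticAt ℝ (fun z : ℝ × ℝ => κ (z.1 * z.2)) 0 := hκ.comp_of_eq hmul (by simp)
  have hρ_mul : AnalyticAt ℝ (fun z : ℝ × ℝ => ρ (z.1 * z.2)) 0 := hρ.comp_of_eq hmul (by simp)
  have hsq : AnalyticAt ℝ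
      (fun z : ℝ × ℝ => (ρ (z.1 * z.2) * z.1 ^ 2, ρ (z.1 * z.2) * z.2 ^ 2)) 0 :=
    (hρ_mul.mul (analyticAt_fst.pow 2)).prod (hρ_mul.mul (analyticAt_snd.pow 2))
  have hsq_tendsto : Tendsto (fun z : ℝ × ℝ =>
      (ρ (z.1 * z.2) * z.1 ^ 2, ρ (z.1 * z.2) * z.2 ^ 2)) (𝓝 0) (𝓝 0) := by
    simpa [Prod.zero_eq_mk] using hsq.continuousAt.tendsto
  refine ⟨hκ.mul ((analyticAt_cosAverage hf).comp_of_eq (hρ.mul analyticAt_id) (by simp)),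
    _, ((analyticAt_const (v := (1 / 2 : ℝ))).mul hκ_mul).mul (hΘ.comp_of_eq hsq (by simp)), ?_⟩
  filter_upwards [hsq_tendsto.eventually (hΘ_eq.and hΘ.eventually_analyticAt),
    tendsto_fst_mul_snd.eventually (hκ.eventually_analyticAt.and hρ.eventually_analyticAt)]
    with z ⟨hz, hΘz⟩ ⟨hκz, hρz⟩
  refine Eq.trans ?_ (congrArg _ (hyperbolicDeriv_comp_sq hΘz.differentiableAt
    hκz.differentiableAt hρz.differentiableAt).symm)
  rw [mul_add (ρ _), hz (ρ (z.1 * z.2) * (z.1 * z.2)) (by ring), mul_add]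

/-! ### Uniqueness of the normal form -/

theorem apply_eq_smul_add_smul {F : Type*} [AddCommMonoid F] [Module ℝ F] [TopologicalSpace F]
    (A : ℝ × ℝ →L[ℝ] F) (w : ℝ × ℝ) : A w = w.1 • A (1, 0) + w.2 • A (0, 1) := by
  rw [← map_smul, ← map_smul, ← map_add]
  simp

theorem det_eq_sub (A : ℝ × ℝ →L[ℝ] ℝ × ℝ) :
    A.det = (A (1, 0)).1 * (A (0, 1)).2 - (A (0, 1)).1 * (A (1, 0)).2 := by
  rw [ContinuousLinearMap.det, ← LinearMap.det_toMatrix (Module.Basis.finTwoProd ℝ),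
    Matrix.det_fin_two]
  simp [LinearMap.toMatrix_apply]

/-- `χ` is a change of coordinates fixing the origin which maps the hyperbolas `x y = const` to
hyperbolas, with profile `E`, and turns the area form `g dx ∧ dy` into `σ dX ∧ dY`. -/
structure IsHyperbolicNormalization (g : ℝ × ℝ → ℝ) (E : ℝ → ℝ) (σ : ℝ)
    (χ : ℝ × ℝ → ℝ × ℝ) : Prop where
  analyticAt : AnalyticAt ℝ χ 0
  map_zero : χ 0 = 0
  analyticAt_profile : AnalyticAt ℝ E 0
  fst_mul_snd : ∀ᶠ w in 𝓝 (0 : ℝ × ℝ), (χ w).1 * (χ w).2 = E (w.1 * w.2)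
  det_mul : ∀ᶠ w in 𝓝 (0 : ℝ × ℝ), (fderiv ℝ χ w).det * g (χ w) = σ

section Uniqueness

variable {g Ψ : ℝ × ℝ → ℝ} {E P : ℝ → ℝ} {σ : ℝ} {χ : ℝ × ℝ → ℝ × ℝ} {z : ℝ × ℝ}

theorem deriv_smul_fderiv_eq_det_smul (hχ : DifferentiableAt ℝ χ z)
    (hE : DifferentiableAt ℝ E (z.1 * z.2))
    (hχE : ∀ᶠ w in 𝓝 z, (χ w).1 * (χ w).2 = E (w.1 * w.2)) :
    deriv E (z.1 * z.2) • fderiv ℝ χ z (z.1, -z.2) =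
      (fderiv ℝ χ z).det • ((χ z).1, -(χ z).2) := by
  have hfst := hasFDerivAt_fst.comp z hχ.hasFDerivAt
  have hsnd := hasFDerivAt_snd.comp z hχ.hasFDerivAt
  have hprofile := hE.hasDerivAt.comp_hasFDerivAt z
    ((hasFDerivAt_fst (𝕜 := ℝ) (p := z)).mul hasFDerivAt_snd)
  have hfderiv := (hfst.mul hsnd).unique (hprofile.congr_of_eventuallyEq hχE)
  have hx := DFunLike.congr_fun hfderiv (1, 0)
  have hy := DFunLike.congr_fun hfderiv (0, 1)
  simp only [Function.comp_apply, add_apply, smul_apply,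
    ContinuousLinearMap.comp_apply, ContinuousLinearMap.coe_fst', ContinuousLinearMap.coe_snd',
    smul_eq_mul, mul_one, mul_zero, add_zero, zero_add] at hx hy
  rw [apply_eq_smul_add_smul _ (z.1, -z.2), det_eq_sub]
  ext <;> simp only [Prod.smul_fst, Prod.smul_snd, Prod.fst_add, Prod.snd_add, smul_eq_mul]
  · linear_combination (fderiv ℝ χ z (0, 1)).1 * hx - (fderiv ℝ χ z (1, 0)).1 * hy
  · linear_combination (fderiv ℝ χ z (0, 1)).2 * hx - (fderiv ℝ χ z (1, 0)).2 * hy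

theorem hyperbolicDeriv_mul_log_add_comp (hχ : DifferentiableAt ℝ χ z)
    (hE : DifferentiableAt ℝ E (z.1 * z.2))
    (hχE : ∀ᶠ w in 𝓝 z, (χ w).1 * (χ w).2 = E (w.1 * w.2))
    (hΨ : DifferentiableAt ℝ Ψ (χ z)) (hne : (χ z).1 ≠ 0) (p : ℝ) :
    deriv E (z.1 * z.2) * hyperbolicDeriv (fun w => p * Real.log (χ w).1 + Ψ (χ w)) z =
      (fderiv ℝ χ z).det * (p + hyperbolicDeriv Ψ (χ z)) := by
  have hpush := deriv_smul_fderiv_eq_det_smul hχ hE hχE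
  have hderiv := (((hasFDerivAt_fst.comp z hχ.hasFDerivAt).log hne).const_mul p).add
    (hΨ.hasFDerivAt.comp z hχ.hasFDerivAt)
  have hlog := congrArg Prod.fst hpush
  have hcomp := congrArg (fderiv ℝ Ψ (χ z)) hpush
  rw [map_smul, map_smul] at hcomp
  simp only [Prod.smul_fst, smul_eq_mul] at hlog hcomp
  have heq : hyperbolicDeriv (fun w => p * Real.log (χ w).1 + Ψ (χ w)) z =
      p * ((χ z).1⁻¹ * (fderiv ℝ χ z (z.1, -z.2)).1) +
        fderiv ℝ Ψ (χ z) (fderiv ℝ χ z (z.1, -z.2)) :=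
    DFunLike.congr_fun hderiv.fderiv _
  rw [heq, hyperbolicDeriv]
  linear_combination p * (χ z).1⁻¹ * hlog + hcomp +
    p * (fderiv ℝ χ z).det * inv_mul_cancel₀ hne

theorem hyperbolicFlow_log_sub_log {δ s : ℝ} (hδ : 0 < δ) (hs : 0 < s) :
    hyperbolicFlow (2 * Real.log δ - Real.log s) (s / δ, δ) = (δ, s / δ) := by
  have hexp : Real.exp (2 * Real.log δ - Real.log s) = δ ^ 2 / s := by
    rw [Real.exp_sub, Real.exp_log hs, two_mul, Real.exp_add, Real.exp_log hδ, sq]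
  rw [hyperbolicFlow, Real.exp_neg, hexp]
  ext <;> simp only <;> field_simp

theorem sub_eq_mul_of_hyperbolicDeriv_eq {V : ℝ × ℝ → ℝ} {δ s c : ℝ} (hδ : 0 < δ) (hs : 0 < s)
    (hsδ : s ≤ δ ^ 2)
    (hV : ∀ z : ℝ × ℝ, |z.1| ≤ δ → |z.2| ≤ δ → z.1 * z.2 = s →
      DifferentiableAt ℝ V z ∧ hyperbolicDeriv V z = c) :
    V (δ, s / δ) - V (s / δ, δ) = c * (2 * Real.log δ - Real.log s) := by
  set T := 2 * Real.log δ - Real.log s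
  have hTnonneg : 0 ≤ T := by
    have hlog := Real.log_le_log hs hsδ
    rw [Real.log_pow] at hlog
    exact sub_nonneg.2 hlog
  have hflow_T := hyperbolicFlow_log_sub_log hδ hs
  have horbit {t : ℝ} (ht : t ∈ uIcc 0 T) :
      DifferentiableAt ℝ V (hyperbolicFlow t (s / δ, δ)) ∧
        hyperbolicDeriv V (hyperbolicFlow t (s / δ, δ)) = c := by
    rw [uIcc_of_le hTnonneg] at ht
    refine hV _ ?_ ?_ ((hyperbolicFlow_fst_mul_snd t _).trans (div_mul_cancel₀ s hδ.ne'))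
    · rw [hyperbolicFlow, abs_of_pos (by positivity)]
      calc s / δ * Real.exp t ≤ s / δ * Real.exp T := by gcongr; exact ht.2
        _ = δ := congrArg Prod.fst hflow_T
    · rw [hyperbolicFlow, abs_of_pos (by positivity)]
      exact mul_le_of_le_one_right hδ.le (Real.exp_le_one_iff.2 (neg_nonpos.2 ht.1))
  have hintegral := intervalIntegral.integral_eq_sub_of_hasDerivAt
    (fun t ht => (hasDerivAt_comp_hyperbolicFlow (horbit ht).1).congr_deriv (horbit ht).2)
    intervalIntegrable_const
  rw [hflow_T, hyperbolicFlow_zero, intervalIntegral.integral_const, sub_zero, smul_eq_mul]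
    at hintegral
  rw [← hintegral, mul_comm]

theorem analyticAt_dslope {f : ℝ → ℝ} {x : ℝ} (hf : AnalyticAt ℝ f x) :
    AnalyticAt ℝ (dslope f x) x := by
  obtain ⟨p, hp⟩ := hf
  exact ⟨_, hp.has_fpower_series_dslope_fslope⟩

theorem not_eventually_pow_mul_log_eq (n : ℕ) {H : ℝ → ℝ} (hH : AnalyticAt ℝ H 0) :
    ¬ ∀ᶠ s in 𝓝[>] (0 : ℝ), s ^ n * Real.log s = H s := by
  intro h
  have hlim : Tendsto H (𝓝[>] 0) (𝓝 (H 0)) := hH.continuousAt.tendsto.mono_left nhdsWithin_le_nhds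
  induction n generalizing H with
  | zero =>
    simp only [pow_zero, one_mul] at h
    exact not_tendsto_nhds_of_tendsto_atBot Real.tendsto_log_nhdsGT_zero _ (hlim.congr' (h.mono
      fun s hs => hs.symm))
  | succ n ih =>
    have hzero : H 0 = 0 := by
      refine tendsto_nhds_unique (hlim.congr' (h.mono fun s hs => hs.symm)) ?_
      refine (tendsto_log_mul_rpow_nhdsGT_zero (r := n + 1) (by positivity)).congr fun s => ?_
      rw [mul_comm]
      norm_cast
    have hdslope := analyticAt_dslope hH
    refine ih hdslope ?_ (hdslope.continuousAt.tendsto.mono_left nhdsWithin_le_nhds)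
    filter_upwards [h, self_mem_nhdsWithin] with s hs (hpos : 0 < s)
    rw [dslope_of_ne _ hpos.ne', slope_def_field, hzero, ← hs, sub_zero, sub_zero, pow_succ',
      mul_assoc, mul_div_cancel_left₀ _ hpos.ne']

theorem eventually_eq_zero_of_mul_log_eq {F G : ℝ → ℝ} (hF : AnalyticAt ℝ F 0)
    (hG : AnalyticAt ℝ G 0) (h : ∀ᶠ s in 𝓝[>] (0 : ℝ), F s * Real.log s = G s) :
    ∀ᶠ s in 𝓝 (0 : ℝ), F s = 0 := by
  by_contra hF_ne
  obtain ⟨n, F₁, hF₁, hF₁_ne, hF_eq⟩ := hF.exists_eventuallyEq_pow_smul_nonzero_iff.2 hF_ne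
  refine not_eventually_pow_mul_log_eq n (hG.div hF₁ hF₁_ne) ?_
  filter_upwards [h, hF_eq.filter_mono nhdsWithin_le_nhds,
    (hF₁.continuousAt.eventually_ne hF₁_ne).filter_mono nhdsWithin_le_nhds] with s hs hFs hF₁s
  rw [Pi.div_apply, eq_div_iff hF₁s, ← hs, hFs, sub_zero, smul_eq_mul]
  ring

theorem analyticAt_log_comp {F : Type*} [NormedAddCommGroup F] [NormedSpace ℝ F] {f : F → ℝ}
    {x : F} (hf : AnalyticAt ℝ f x) (hx : f x ≠ 0) :
    AnalyticAt ℝ (fun z => Real.log (f z)) x :=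
  (Real.contDiffAt_log (n := ⊤).2 hx).analyticAt.comp hf

theorem analyticAt_sqrt_comp {F : Type*} [NormedAddCommGroup F] [NormedSpace ℝ F] {f : F → ℝ}
    {x : F} (hf : AnalyticAt ℝ f x) (hx : f x ≠ 0) : AnalyticAt ℝ (fun z => √(f z)) x :=
  (Real.contDiffAt_sqrt (n := ⊤) hx).analyticAt.comp hf

theorem eventually_apply_smul_ne_zero {f : ℝ × ℝ → ℝ} (hf : DifferentiableAt ℝ f 0)
    {v : ℝ × ℝ} (hv : fderiv ℝ f 0 v ≠ 0) : ∀ᶠ t in 𝓝[≠] (0 : ℝ), f (t • v) ≠ 0 := by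
  have hline : HasDerivAt (fun t : ℝ => f (0 + t • v)) (fderiv ℝ f 0 v) 0 :=
    hf.hasFDerivAt.hasLineDerivAt v
  simpa only [zero_add] using hline.eventually_ne hv

theorem IsHyperbolicNormalization.profile_zero (h : IsHyperbolicNormalization g E σ χ) :
    E 0 = 0 := by
  simpa [h.map_zero] using h.fst_mul_snd.self_of_nhds.symm

theorem IsHyperbolicNormalization.tendsto (h : IsHyperbolicNormalization g E σ χ) :
    Tendsto χ (𝓝 0) (𝓝 0) := by
  simpa [h.map_zero] using h.analyticAt.continuousAt.tendsto

theorem IsHyperbolicNormalization.eventually_hyperbolicDeriv_eq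
    (h : IsHyperbolicNormalization g E σ χ) (hΨ : AnalyticAt ℝ Ψ 0)
    (hg : ∀ᶠ z in 𝓝 (0 : ℝ × ℝ), g z = P (z.1 * z.2) + hyperbolicDeriv Ψ z) :
    ∀ᶠ z in 𝓝 (0 : ℝ × ℝ), (χ z).1 ≠ 0 →
      deriv E (z.1 * z.2) *
        hyperbolicDeriv (fun w => P (E (z.1 * z.2)) * Real.log (χ w).1 + Ψ (χ w)) z = σ := by
  filter_upwards [h.analyticAt.eventually_analyticAt, h.fst_mul_snd.eventually_nhds, h.det_mul,
    h.tendsto.eventually hΨ.eventually_analyticAt, h.tendsto.eventually hg,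
    tendsto_fst_mul_snd.eventually h.analyticAt_profile.eventually_analyticAt]
    with z hχz hχE hdet hΨz hgz hEz hne
  rw [hyperbolicDeriv_mul_log_add_comp hχz.differentiableAt hEz.differentiableAt hχE
    hΨz.differentiableAt hne, ← hdet, hgz, hχE.self_of_nhds]

/-- The part of the integral of `P (E s) * d (log (χ z).1) + d (Ψ ∘ χ)` along the arc of the
hyperbola `x y = s` from `(s / δ, δ)` to `(δ, s / δ)` that stays analytic as `s → 0`. -/
def regularizedIntegral (Ψ : ℝ × ℝ → ℝ) (P E : ℝ → ℝ) (χ : ℝ × ℝ → ℝ × ℝ) (δ s : ℝ) : ℝ :=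
  P (E s) * (Real.log (χ (δ, s / δ)).1 + Real.log (χ (s / δ, δ)).2 - Real.log (dslope E 0 s)) +
    (Ψ (χ (δ, s / δ)) - Ψ (χ (s / δ, δ)))

theorem analyticAt_regularizedIntegral {δ : ℝ} (hP : AnalyticAt ℝ P 0) (hE : AnalyticAt ℝ E 0)
    (hE_zero : E 0 = 0) (hE_deriv : deriv E 0 ≠ 0)
    (hχa : AnalyticAt ℝ χ (δ, 0)) (hχb : AnalyticAt ℝ χ (0, δ))
    (hΨa : AnalyticAt ℝ Ψ (χ (δ, 0))) (hΨb : AnalyticAt ℝ Ψ (χ (0, δ)))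
    (hane : (χ (δ, 0)).1 ≠ 0) (hbne : (χ (0, δ)).2 ≠ 0) :
    AnalyticAt ℝ (regularizedIntegral Ψ P E χ δ) 0 := by
  have hdiv : AnalyticAt ℝ (fun s : ℝ => s / δ) 0 := analyticAt_id.div_const
  have ha : AnalyticAt ℝ (fun s : ℝ => χ (δ, s / δ)) 0 :=
    hχa.comp_of_eq (analyticAt_const.prod hdiv) (by simp)
  have hb : AnalyticAt ℝ (fun s : ℝ => χ (s / δ, δ)) 0 :=
    hχb.comp_of_eq (hdiv.prod analyticAt_const) (by simp)
  have hlog_fst : AnalyticAt ℝ (fun s : ℝ => Real.log (χ (δ, s / δ)).1) 0 :=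
    analyticAt_log_comp (analyticAt_fst.comp ha) (by simpa using hane)
  have hlog_snd : AnalyticAt ℝ (fun s : ℝ => Real.log (χ (s / δ, δ)).2) 0 :=
    analyticAt_log_comp (analyticAt_snd.comp hb) (by simpa using hbne)
  have hlog_dslope : AnalyticAt ℝ (fun s : ℝ => Real.log (dslope E 0 s)) 0 :=
    analyticAt_log_comp (analyticAt_dslope hE) (by rwa [dslope_same])
  exact ((hP.comp_of_eq hE hE_zero).mul ((hlog_fst.add hlog_snd).sub hlog_dslope)).add
    ((hΨa.comp_of_eq ha (by simp)).sub (hΨb.comp_of_eq hb (by simp)))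

theorem mul_log_eq_regularizedIntegral_sub {δ s : ℝ} (hδ : 0 < δ) (hs : 0 < s) (hsδ : s ≤ δ ^ 2)
    (hE_zero : E 0 = 0) (hE_dslope : dslope E 0 s ≠ 0) (hE_deriv : deriv E s ≠ 0)
    (hbox : ∀ z : ℝ × ℝ, |z.1| ≤ δ → |z.2| ≤ δ → z.1 * z.2 = s →
      DifferentiableAt ℝ χ z ∧ DifferentiableAt ℝ Ψ (χ z) ∧ (χ z).1 * (χ z).2 = E s ∧
      ((χ z).1 ≠ 0 → deriv E s *
        hyperbolicDeriv (fun w => P (E s) * Real.log (χ w).1 + Ψ (χ w)) z = σ)) :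
    (P (E s) - σ / deriv E s) * Real.log s =
      regularizedIntegral Ψ P E χ δ s - σ / deriv E s * (2 * Real.log δ) := by
  have hE_eq : E s = s * dslope E 0 s := by
    have hsub := sub_smul_dslope E 0 s
    rw [sub_zero, hE_zero, sub_zero, smul_eq_mul] at hsub
    exact hsub.symm
  have hE_ne : E s ≠ 0 := by
    rw [hE_eq]
    exact mul_ne_zero hs.ne' hE_dslope
  have hχ_ne {z : ℝ × ℝ} (hz : (χ z).1 * (χ z).2 = E s) : (χ z).1 ≠ 0 ∧ (χ z).2 ≠ 0 :=
    mul_ne_zero_iff.1 (hz.trans_ne hE_ne)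
  have harc := sub_eq_mul_of_hyperbolicDeriv_eq
    (V := fun w => P (E s) * Real.log (χ w).1 + Ψ (χ w)) hδ hs hsδ fun z hz₁ hz₂ hzs => by
      obtain ⟨hχz, hΨz, hprod, hderiv⟩ := hbox z hz₁ hz₂ hzs
      obtain ⟨hne, -⟩ := hχ_ne hprod
      exact ⟨((hχz.fst.log hne).const_mul _).add (hΨz.comp z hχz),
        eq_div_of_mul_eq hE_deriv ((mul_comm _ _).trans (hderiv hne))⟩
  have hstart : (χ (s / δ, δ)).1 * (χ (s / δ, δ)).2 = E s := by
    refine (hbox (s / δ, δ) ?_ (abs_of_pos hδ).le (div_mul_cancel₀ s hδ.ne')).2.2.1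
    rw [abs_of_pos (by positivity), div_le_iff₀ hδ]
    exact hsδ.trans_eq (sq δ)
  have hlog := congrArg Real.log hstart
  rw [Real.log_mul (hχ_ne hstart).1 (hχ_ne hstart).2, hE_eq, Real.log_mul hs.ne' hE_dslope] at hlog
  rw [regularizedIntegral]
  linear_combination -harc - P (E s) * hlog

theorem IsHyperbolicNormalization.deriv_mul_average_eq_of_ne_zero
    (h : IsHyperbolicNormalization g E σ χ) (hg : IsHyperbolicAverage g P)
    (hE : deriv E 0 ≠ 0) (hfst : fderiv ℝ (fun w => (χ w).1) 0 (1, 0) ≠ 0)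
    (hsnd : fderiv ℝ (fun w => (χ w).2) 0 (0, 1) ≠ 0) :
    ∀ᶠ s in 𝓝 (0 : ℝ), deriv E s * P (E s) = σ := by
  obtain ⟨hP, Ψ, hΨ, hΨ_eq⟩ := hg
  have hχ := h.analyticAt.differentiableAt
  obtain ⟨r, hr, hball⟩ := Metric.eventually_nhds_iff.1
    (h.analyticAt.eventually_analyticAt.and ((h.tendsto.eventually hΨ.eventually_analyticAt).and
      (h.fst_mul_snd.and (h.eventually_hyperbolicDeriv_eq hΨ hΨ_eq))))
  obtain ⟨δ, ⟨hane, hbne⟩, hδ, hδr⟩ := ((((eventually_apply_smul_ne_zero hχ.fst hfst).and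
    (eventually_apply_smul_ne_zero hχ.snd hsnd)).filter_mono (nhdsGT_le_nhdsNE 0)).and
      (Ioo_mem_nhdsGT hr)).exists
  simp only [Prod.smul_mk, smul_eq_mul, mul_one, mul_zero] at hane hbne
  have hbox {z : ℝ × ℝ} (hz₁ : |z.1| ≤ δ) (hz₂ : |z.2| ≤ δ) : dist z 0 < r := by
    rw [dist_zero_right, Prod.norm_def]
    exact (max_le hz₁ hz₂).trans_lt hδr
  obtain ⟨hχa, hΨa, -⟩ := hball (y := (δ, 0)) (hbox (abs_of_pos hδ).le (by simpa using hδ.le))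
  obtain ⟨hχb, hΨb, -⟩ := hball (y := (0, δ)) (hbox (by simpa using hδ.le) (abs_of_pos hδ).le)
  have hEa := h.analyticAt_profile
  have hratio : AnalyticAt ℝ (fun s => σ / deriv E s) 0 := analyticAt_const.div hEa.deriv hE
  have hderiv_ne := hEa.deriv.continuousAt.eventually_ne hE
  have hdslope_ne : ∀ᶠ s in 𝓝 (0 : ℝ), dslope E 0 s ≠ 0 :=
    (analyticAt_dslope hEa).continuousAt.eventually_ne (by rwa [dslope_same])
  have hzero := eventually_eq_zero_of_mul_log_eq
    ((hP.comp_of_eq hEa h.profile_zero).sub hratio)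
    ((analyticAt_regularizedIntegral hP hEa h.profile_zero hE hχa hχb hΨa hΨb hane hbne).sub
      (hratio.mul analyticAt_const)) (by
    filter_upwards [Ioo_mem_nhdsGT (show 0 < δ ^ 2 by positivity),
      nhdsWithin_le_nhds (hderiv_ne.and hdslope_ne)] with s hs ⟨hs_deriv, hs_dslope⟩
    refine mul_log_eq_regularizedIntegral_sub hδ hs.1 hs.2.le h.profile_zero hs_dslope hs_deriv ?_
    rintro z hz₁ hz₂ rfl
    obtain ⟨hχz, hΨz, hprod, hderiv⟩ := hball (hbox hz₁ hz₂)
    exact ⟨hχz.differentiableAt, hΨz.differentiableAt, hprod, hderiv⟩)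
  filter_upwards [hzero, hderiv_ne] with s hs hs_ne
  have hs_eq : P (E s) = σ / deriv E s := sub_eq_zero.1 hs
  rw [hs_eq, mul_div_cancel₀ σ hs_ne]

theorem IsHyperbolicNormalization.fderiv_fst_mul_fderiv_snd
    (h : IsHyperbolicNormalization g E σ χ) (v : ℝ × ℝ) :
    (fderiv ℝ χ 0 v).1 * (fderiv ℝ χ 0 v).2 = deriv E 0 * (v.1 * v.2) := by
  have hline : HasDerivAt (fun t : ℝ => χ (t • v)) (fderiv ℝ χ 0 v) 0 := by
    have hline : HasDerivAt (fun t : ℝ => χ (0 + t • v)) (fderiv ℝ χ 0 v) 0 :=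
      h.analyticAt.differentiableAt.hasFDerivAt.hasLineDerivAt v
    simpa only [zero_add] using hline
  have hslope := hline.tendsto_slope_zero
  have hprofile : HasDerivAt (fun u : ℝ => E (u * (v.1 * v.2))) (deriv E 0 * (v.1 * v.2)) 0 :=
    HasDerivAt.comp 0 (by simpa using h.analyticAt_profile.differentiableAt.hasDerivAt)
      (hasDerivAt_mul_const (v.1 * v.2))
  have hsq : Tendsto (fun t : ℝ => t ^ 2) (𝓝[≠] 0) (𝓝[≠] 0) :=
    tendsto_nhdsWithin_iff.2 ⟨(by simpa using (continuous_pow 2).tendsto (0 : ℝ) :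
      Tendsto (fun t : ℝ => t ^ 2) (𝓝 0) (𝓝 0)).mono_left nhdsWithin_le_nhds,
      eventually_mem_nhdsWithin.mono fun t ht => pow_ne_zero 2 ht⟩
  have hcont : Continuous fun t : ℝ => t • v := by fun_prop
  have hsmul : Tendsto (fun t : ℝ => t • v) (𝓝[≠] 0) (𝓝 0) :=
    (by simpa using hcont.tendsto 0 :
      Tendsto (fun t : ℝ => t • v) (𝓝 0) (𝓝 0)).mono_left nhdsWithin_le_nhds
  refine tendsto_nhds_unique (hslope.fst_nhds.mul hslope.snd_nhds)
    ((hprofile.tendsto_slope_zero.comp hsq).congr' ?_)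
  filter_upwards [hsmul.eventually h.fst_mul_snd] with t ht
  simp only [Prod.smul_fst, Prod.smul_snd, smul_eq_mul, zero_add, zero_smul, h.map_zero, zero_mul,
    h.profile_zero, sub_zero, Function.comp_apply] at ht ⊢
  rw [mul_mul_mul_comm, ht, mul_mul_mul_comm, sq, mul_inv]

theorem IsHyperbolicNormalization.deriv_profile_ne_zero (h : IsHyperbolicNormalization g E σ χ)
    (hσ : σ ≠ 0) :
    deriv E 0 ≠ 0 ∧ ((fderiv ℝ χ 0 (1, 0)).1 ≠ 0 ∧ (fderiv ℝ χ 0 (0, 1)).2 ≠ 0 ∨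
      (fderiv ℝ χ 0 (0, 1)).1 ≠ 0 ∧ (fderiv ℝ χ 0 (1, 0)).2 ≠ 0) := by
  have hdet : (fderiv ℝ χ 0).det ≠ 0 := left_ne_zero_of_mul (h.det_mul.self_of_nhds.trans_ne hσ)
  rw [det_eq_sub] at hdet
  have hx := h.fderiv_fst_mul_fderiv_snd (1, 0)
  have hy := h.fderiv_fst_mul_fderiv_snd (0, 1)
  have hxy := h.fderiv_fst_mul_fderiv_snd (1, 1)
  rw [apply_eq_smul_add_smul _ (1, 1)] at hxy
  simp only [one_smul, Prod.fst_add, Prod.snd_add, mul_zero, mul_one] at hx hy hxy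
  grind

theorem IsHyperbolicNormalization.comp_swap (h : IsHyperbolicNormalization g E σ χ) :
    IsHyperbolicNormalization g E (-σ) (χ ∘ ContinuousLinearEquiv.prodComm ℝ ℝ ℝ) := by
  have hswap : Tendsto (ContinuousLinearEquiv.prodComm ℝ ℝ ℝ) (𝓝 0) (𝓝 0) := by
    simpa using (ContinuousLinearEquiv.prodComm ℝ ℝ ℝ).continuous.tendsto 0
  refine ⟨h.analyticAt.comp_of_eq (ContinuousLinearEquiv.analyticAt _ _) (_root_.map_zero _), ?_,
    h.analyticAt_profile, ?_, ?_⟩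
  · simpa using h.map_zero
  · filter_upwards [hswap.eventually h.fst_mul_snd] with w hw
    rw [Function.comp_apply, hw, mul_comm w.1]
    rfl
  · filter_upwards [hswap.eventually h.det_mul] with w hw
    rw [← hw, ContinuousLinearEquiv.comp_right_fderiv, det_eq_sub, det_eq_sub, ← neg_mul]
    congr 1
    simp

theorem IsHyperbolicNormalization.deriv_mul_average_eq_or_neg
    (h : IsHyperbolicNormalization g E σ χ) (hg : IsHyperbolicAverage g P) (hσ : σ ≠ 0) :
    (∀ᶠ s in 𝓝 (0 : ℝ), deriv E s * P (E s) = σ) ∨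
      ∀ᶠ s in 𝓝 (0 : ℝ), deriv E s * P (E s) = -σ := by
  have hχ := h.analyticAt.differentiableAt
  obtain ⟨hE, ⟨hfst, hsnd⟩ | ⟨hfst, hsnd⟩⟩ := h.deriv_profile_ne_zero hσ
  · refine Or.inl (h.deriv_mul_average_eq_of_ne_zero hg hE ?_ ?_)
    · rwa [fderiv.fst hχ]
    · rwa [fderiv.snd hχ]
  · refine Or.inr (h.comp_swap.deriv_mul_average_eq_of_ne_zero hg hE ?_ ?_)
    · rw [fderiv.fst h.comp_swap.analyticAt.differentiableAt,
        ContinuousLinearEquiv.comp_right_fderiv]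
      simpa using hfst
    · rw [fderiv.snd h.comp_swap.analyticAt.differentiableAt,
        ContinuousLinearEquiv.comp_right_fderiv]
      simpa using hsnd

theorem IsHyperbolicNormalization.deriv_mul_average_eq_sign
    (h : IsHyperbolicNormalization g E 1 χ) (hg : IsHyperbolicAverage g P) (hP : 0 < P 0) :
    ∀ᶠ s in 𝓝 (0 : ℝ), deriv E s * P (E s) = SignType.sign (deriv E 0) := by
  obtain hpos | hneg := h.deriv_mul_average_eq_or_neg hg one_ne_zero
  · have hzero := hpos.self_of_nhds
    rw [h.profile_zero] at hzero
    rw [sign_pos (pos_of_mul_pos_left (hzero.symm ▸ one_pos) hP.le)]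
    simpa using hpos
  · have hzero := hneg.self_of_nhds
    rw [h.profile_zero] at hzero
    rw [sign_neg (neg_of_mul_neg_left (hzero.symm ▸ neg_one_lt_zero) hP.le)]
    simpa using hneg

end Uniqueness

/-! ### Existence of the normal form -/

theorem exists_hasDerivAt_id_mul {P : ℝ → ℝ} (hP : AnalyticAt ℝ P 0) :
    ∃ U : ℝ → ℝ, AnalyticAt ℝ U 0 ∧
      ∀ᶠ s in 𝓝 (0 : ℝ), HasDerivAt (fun s => s * U s) (P s) s := by
  refine ⟨fun s => ∫ u in (0 : ℝ)..1, P (s * u),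
    analyticAt_integral_comp_mul hP continuous_id 0 1, ?_⟩
  obtain ⟨r, hr, hball⟩ := Metric.eventually_nhds_iff_ball.1 hP.eventually_analyticAt
  have hcont : ContinuousOn P (Metric.ball 0 r) := fun s hs =>
    (hball s hs).continuousAt.continuousWithinAt
  filter_upwards [Metric.ball_mem_nhds (0 : ℝ) hr] with s hs
  simp only [intervalIntegral.mul_integral_comp_mul_left, mul_zero, mul_one]
  exact intervalIntegral.integral_hasDerivAt_right
    (hcont.mono ((convex_ball 0 r).ordConnected.uIcc_subset
      (Metric.mem_ball_self hr) hs)).intervalIntegrable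
    (hcont.stronglyMeasurableAtFilter Metric.isOpen_ball s hs) (hball s hs).continuousAt

theorem exists_analyticAt_rightInverse {F : ℝ × ℝ → ℝ × ℝ} (hF : AnalyticAt ℝ F 0)
    (hF_zero : F 0 = 0) (hdet : (fderiv ℝ F 0).det ≠ 0) :
    ∃ χ : ℝ × ℝ → ℝ × ℝ, AnalyticAt ℝ χ 0 ∧ χ 0 = 0 ∧ ∀ᶠ w in 𝓝 (0 : ℝ × ℝ), F (χ w) = w := by
  have hsmooth : ContDiffAt ℝ ω F 0 := hF.contDiffAt
  have hderiv : HasFDerivAt F ((fderiv ℝ F 0).toContinuousLinearEquivOfDetNeZero hdet :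
      ℝ × ℝ →L[ℝ] ℝ × ℝ) 0 := by
    simpa using hF.differentiableAt.hasFDerivAt
  refine ⟨hsmooth.localInverse hderiv (by simp), ?_, ?_, ?_⟩
  · simpa [hF_zero] using (hsmooth.to_localInverse hderiv (by simp)).analyticAt
  · simpa [hF_zero] using hsmooth.localInverse_apply_image hderiv (by simp)
  · have hright := (hsmooth.hasStrictFDerivAt' hderiv (by simp)).eventually_right_inverse
    rwa [hF_zero] at hright

theorem exists_analyticAt_leftInverse {T : ℝ → ℝ} (hT : AnalyticAt ℝ T 0) (hT_zero : T 0 = 0)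
    (hT_deriv : deriv T 0 ≠ 0) :
    ∃ E : ℝ → ℝ, AnalyticAt ℝ E 0 ∧ deriv E 0 = (deriv T 0)⁻¹ ∧
      ∀ᶠ s in 𝓝 (0 : ℝ), E (T s) = s := by
  refine ⟨hT.hasStrictDerivAt.localInverse _ _ _ hT_deriv, ?_, ?_, ?_⟩
  · simpa only [hT_zero] using hT.analyticAt_localInverse hT_deriv
  · simpa only [hT_zero] using (hT.hasStrictDerivAt.to_localInverse hT_deriv).hasDerivAt.deriv
  · exact (hT.hasStrictDerivAt.hasStrictFDerivAt_equiv hT_deriv).eventually_left_inverse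

theorem exists_isHyperbolicNormalization_of_det_eq {g : ℝ × ℝ → ℝ} {F : ℝ × ℝ → ℝ × ℝ}
    {T : ℝ → ℝ} (hF : AnalyticAt ℝ F 0) (hF_zero : F 0 = 0)
    (hdet : ∀ᶠ z in 𝓝 (0 : ℝ × ℝ), (fderiv ℝ F z).det = g z) (hg : g 0 ≠ 0)
    (hT : AnalyticAt ℝ T 0) (hT_deriv : deriv T 0 ≠ 0)
    (hFT : ∀ᶠ z in 𝓝 (0 : ℝ × ℝ), (F z).1 * (F z).2 = T (z.1 * z.2)) :
    ∃ E χ, IsHyperbolicNormalization g E 1 χ ∧ deriv E 0 = (deriv T 0)⁻¹ := by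
  have hT_zero : T 0 = 0 := by simpa [hF_zero] using hFT.self_of_nhds.symm
  obtain ⟨χ, hχ, hχ_zero, hFχ⟩ := exists_analyticAt_rightInverse hF hF_zero
    (hdet.self_of_nhds.trans_ne hg)
  obtain ⟨E, hE, hE_deriv, hET⟩ := exists_analyticAt_leftInverse hT hT_zero hT_deriv
  have hχ_tendsto : Tendsto χ (𝓝 0) (𝓝 0) := by
    simpa only [hχ_zero] using hχ.continuousAt.tendsto
  refine ⟨E, χ, ⟨hχ, hχ_zero, hE, ?_, ?_⟩, hE_deriv⟩
  · filter_upwards [hFχ, hχ_tendsto.eventually hFT,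
      (tendsto_fst_mul_snd.comp hχ_tendsto).eventually hET] with w hw hprod hleft
    rw [hw] at hprod
    rw [hprod]
    exact hleft.symm
  · filter_upwards [hFχ.eventually_nhds, hχ.eventually_analyticAt,
      hχ_tendsto.eventually hdet, hχ_tendsto.eventually hF.eventually_analyticAt]
      with w hw hχw hdetw hFw
    have hid : (fderiv ℝ F (χ w)).comp (fderiv ℝ χ w) = ContinuousLinearMap.id ℝ (ℝ × ℝ) :=
      (hFw.differentiableAt.hasFDerivAt.comp w hχw.differentiableAt.hasFDerivAt).unique
        ((hasFDerivAt_id w).congr_of_eventuallyEq hw)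
    rw [← hdetw, mul_comm, ContinuousLinearMap.det, ContinuousLinearMap.det, ← LinearMap.det_comp,
      ← ContinuousLinearMap.toLinearMap_comp, hid, ContinuousLinearMap.coe_id,
      LinearMap.det_id]

/-- The map `(x, y) ↦ (x e^φ, y U(x y) e^{-φ})`: a rescaling of the hyperbolas `x y = const`
followed by the time-`φ` map of the hyperbolic flow. -/
def hyperbolicRescaling (U : ℝ → ℝ) (φ : ℝ × ℝ → ℝ) (z : ℝ × ℝ) : ℝ × ℝ :=
  hyperbolicFlow (φ z) (z.1, z.2 * U (z.1 * z.2))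

theorem det_fderiv_hyperbolicRescaling {U : ℝ → ℝ} {φ : ℝ × ℝ → ℝ} {z : ℝ × ℝ}
    (hU : DifferentiableAt ℝ U (z.1 * z.2)) (hφ : DifferentiableAt ℝ φ z) :
    (fderiv ℝ (hyperbolicRescaling U φ) z).det =
      (U (z.1 * z.2) + z.1 * z.2 * deriv U (z.1 * z.2)) * (1 + hyperbolicDeriv φ z) := by
  have hfst : HasFDerivAt (fun z : ℝ × ℝ => z.1) _ z := hasFDerivAt_fst (𝕜 := ℝ)
  have hsnd : HasFDerivAt (fun z : ℝ × ℝ => z.2) _ z := hasFDerivAt_snd (𝕜 := ℝ)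
  have hX := hfst.mul hφ.hasFDerivAt.exp
  have hY := (hsnd.mul (hU.hasDerivAt.comp_hasFDerivAt z (hfst.mul hsnd))).mul
    hφ.hasFDerivAt.neg.exp
  have hderiv : HasFDerivAt (hyperbolicRescaling U φ) _ z := hX.prodMk hY
  have hexp : Real.exp (φ z) * Real.exp (-φ z) = 1 := by
    rw [← Real.exp_add, add_neg_cancel, Real.exp_zero]
  rw [hderiv.fderiv, det_eq_sub, hyperbolicDeriv, apply_eq_smul_add_smul _ (z.1, -z.2)]
  simp only [Pi.mul_apply, Function.comp_apply, Pi.neg_apply, smul_neg, smul_add,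
    ContinuousLinearMap.prod_apply, add_apply, smul_apply, smul_eq_mul,
    ContinuousLinearMap.coe_fst', mul_one, neg_apply, ContinuousLinearMap.coe_snd', mul_zero,
    zero_add, add_zero, neg_mul]
  linear_combination (U (z.1 * z.2) + z.1 * z.2 * deriv U (z.1 * z.2)) *
    (1 + (z.1 * fderiv ℝ φ z (1, 0) - z.2 * fderiv ℝ φ z (0, 1))) * hexp

theorem hyperbolicDeriv_comp_mul {p : ℝ → ℝ} {Ψ : ℝ × ℝ → ℝ} {z : ℝ × ℝ}
    (hp : DifferentiableAt ℝ p (z.1 * z.2)) (hΨ : DifferentiableAt ℝ Ψ z) :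
    hyperbolicDeriv (fun z => p (z.1 * z.2) * Ψ z) z = p (z.1 * z.2) * hyperbolicDeriv Ψ z := by
  have hmul : DifferentiableAt ℝ (fun z : ℝ × ℝ => z.1 * z.2) z := by fun_prop
  have hpz : DifferentiableAt ℝ (fun z : ℝ × ℝ => p (z.1 * z.2)) z := hp.comp z hmul
  refine hyperbolicDeriv_eq_of_hasDerivAt (hpz.mul hΨ) ?_
  simp only [hyperbolicFlow_fst_mul_snd]
  have hflow := hasDerivAt_comp_hyperbolicFlow (Ψ := Ψ) (t := 0) (by rwa [hyperbolicFlow_zero])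
  rw [hyperbolicFlow_zero] at hflow
  exact hflow.const_mul _

theorem IsHyperbolicAverage.exists_isHyperbolicNormalization {g : ℝ × ℝ → ℝ} {P : ℝ → ℝ}
    (h : IsHyperbolicAverage g P) (hP_pos : 0 < P 0) :
    ∃ E χ, IsHyperbolicNormalization g E 1 χ ∧ 0 < deriv E 0 := by
  obtain ⟨hP, Ψ, hΨ, hg⟩ := h
  obtain ⟨U, hU, hPU⟩ := exists_hasDerivAt_id_mul hP
  have hmul : AnalyticAt ℝ (fun z : ℝ × ℝ => z.1 * z.2) 0 := analyticAt_fst.mul analyticAt_snd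
  have hP_inv : AnalyticAt ℝ (fun s => (P s)⁻¹) 0 := hP.inv hP_pos.ne'
  have hφ : AnalyticAt ℝ (fun z : ℝ × ℝ => (P (z.1 * z.2))⁻¹ * Ψ z) 0 :=
    (hP_inv.comp_of_eq hmul (by simp)).mul hΨ
  have hdet : ∀ᶠ z in 𝓝 (0 : ℝ × ℝ),
      (fderiv ℝ (hyperbolicRescaling U fun z => (P (z.1 * z.2))⁻¹ * Ψ z) z).det = g z := by
    filter_upwards [tendsto_fst_mul_snd.eventually (hU.eventually_analyticAt.and hPU),
      tendsto_fst_mul_snd.eventually ((hP.continuousAt.eventually_ne hP_pos.ne').and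
        hP_inv.eventually_analyticAt), hΨ.eventually_analyticAt, hφ.eventually_analyticAt, hg]
      with z ⟨hUz, hPUz⟩ ⟨hPz, hP_invz⟩ hΨz hφz hgz
    have hPU_eq : P (z.1 * z.2) = U (z.1 * z.2) + z.1 * z.2 * deriv U (z.1 * z.2) := by
      simpa using hPUz.unique ((hasDerivAt_id _).mul hUz.differentiableAt.hasDerivAt)
    rw [det_fderiv_hyperbolicRescaling hUz.differentiableAt hφz.differentiableAt, ← hPU_eq,
      hyperbolicDeriv_comp_mul hP_invz.differentiableAt hΨz.differentiableAt, hgz, mul_add,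
      mul_one, mul_inv_cancel_left₀ hPz]
  have hg_zero : g 0 = P 0 := by
    simpa [hyperbolicDeriv, Prod.mk_zero_zero] using hg.self_of_nhds
  have hderiv := hPU.self_of_nhds.deriv
  obtain ⟨E, χ, hχ, hE⟩ := exists_isHyperbolicNormalization_of_det_eq
    (F := hyperbolicRescaling U fun z => (P (z.1 * z.2))⁻¹ * Ψ z) (T := fun s => s * U s)
    ((analyticAt_fst.mul hφ.rexp).prod
      ((analyticAt_snd.mul (hU.comp_of_eq hmul (by simp))).mul hφ.neg.rexp))
    (by simp [hyperbolicRescaling, hyperbolicFlow]) hdet (hg_zero.trans_ne hP_pos.ne')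
    (analyticAt_id.mul hU) (hderiv.trans_ne hP_pos.ne')
    (.of_forall fun z => by
      rw [hyperbolicRescaling, hyperbolicFlow_fst_mul_snd, mul_assoc])
  exact ⟨E, χ, hχ, by rwa [hE, hderiv, inv_pos]⟩

/-! ### The rigid body near a hyperbolic equilibrium -/

theorem ellipticK_eq_integral_sin (t : ℝ) :
    ellipticK t = ∫ φ in (0 : ℝ)..(Real.pi / 2), 1 / √(1 - t * Real.sin φ ^ 2) := by
  have hcos {φ : ℝ} (hφ : φ ∈ Ioo 0 (Real.pi / 2)) : 0 < Real.cos φ :=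
    Real.cos_pos_of_mem_Ioo ⟨(neg_neg_of_pos Real.pi_div_two_pos).trans hφ.1, hφ.2⟩
  have hsubst := intervalIntegral.integral_deriv_smul_comp_of_deriv_nonneg (a := 0)
    (b := Real.pi / 2) (g := fun x => 1 / √((1 - x ^ 2) * (1 - t * x ^ 2)))
    Real.continuous_sin.continuousOn (fun φ _ => Real.hasDerivAt_sin φ)
    (by simpa [Real.pi_div_two_pos.le] using fun φ h h' => (hcos ⟨h, h'⟩).le)
  rw [Real.sin_zero, Real.sin_pi_div_two] at hsubst
  rw [ellipticK, ← hsubst]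
  refine intervalIntegral.integral_congr_Ioo_of_le Real.pi_div_two_pos.le fun φ hφ => ?_
  simp only [Function.comp_apply, smul_eq_mul]
  rw [← Real.cos_sq', Real.sqrt_mul (sq_nonneg _), Real.sqrt_sq (hcos hφ).le, mul_one_div,
    div_mul_cancel_left₀ (hcos hφ).ne', one_div]

theorem ellipticK_zero : ellipticK 0 = Real.pi / 2 := by
  simp [ellipticK_eq_integral_sin]

theorem cosAverage_one_div_sqrt {s : ℝ} (hs : 0 < 1 + 2 * s) :
    cosAverage (fun w => 1 / √(1 - w)) s =
      2 / (Real.pi * √(1 + 2 * s)) * ellipticK (4 * s / (1 + 2 * s)) := by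
  have hhalf (φ : ℝ) : 1 / √(1 - s * (2 * Real.cos (Real.pi - 2 * φ))) =
      1 / √(1 + 2 * s) * (1 / √(1 - 4 * s / (1 + 2 * s) * Real.sin φ ^ 2)) := by
    rw [one_div_mul_one_div, ← Real.sqrt_mul hs.le, Real.cos_pi_sub, Real.cos_two_mul,
      Real.cos_sq']
    congr 2
    linear_combination Real.sin φ ^ 2 * div_mul_cancel₀ (4 * s) hs.ne'
  have hsubst := intervalIntegral.mul_integral_comp_sub_mul (a := 0) (b := Real.pi / 2)
    (f := fun θ => 1 / √(1 - s * (2 * Real.cos θ))) 2 Real.pi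
  rw [mul_div_cancel₀ _ two_ne_zero, sub_self, mul_zero, sub_zero] at hsubst
  simp only [cosAverage, ← hsubst, hhalf, intervalIntegral.integral_const_mul,
    ← ellipticK_eq_integral_sin]
  ring

section Sphere

variable {I₁ I₂ I₃ l m₁ m₃ ε : ℝ}

/-- The density of the symplectic form with respect to `dx ∧ dy` in the coordinates
`x = m₁ p₁ ± m₃ p₃`, `y = m₁ p₁ ∓ m₃ p₃` on the sphere; the root is `|p₂|`. -/
def orbitDensity (l m₁ m₃ : ℝ) (z : ℝ × ℝ) : ℝ :=
  1 / (6 * m₁ * m₃ *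
    √(2 * l - ((z.1 + z.2) / (2 * m₁)) ^ 2 - ((z.1 - z.2) / (2 * m₃)) ^ 2))

/-- The mean of `orbitDensity` over the vanishing cycle `x y = s`. -/
def orbitPeriod (l m₁ m₃ s : ℝ) : ℝ :=
  1 / (3 * Real.pi * (m₁ * √(2 * l * m₃ ^ 2 + s))) *
    ellipticK ((m₁ ^ 2 + m₃ ^ 2) * s / (m₁ ^ 2 * (2 * l * m₃ ^ 2 + s)))

theorem orbitPeriod_zero_pos (hl : 0 < l) (hm₁ : 0 < m₁) (hm₃ : 0 < m₃) :
    0 < orbitPeriod l m₁ m₃ 0 := by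
  rw [orbitPeriod, mul_zero, zero_div, ellipticK_zero]
  positivity

/-- The part of the radicand in `orbitDensity` which depends on `x y = s` only. -/
def cycleRadicand (l m₁ m₃ s : ℝ) : ℝ :=
  2 * l - (1 / (2 * m₁ ^ 2) - 1 / (2 * m₃ ^ 2)) * s

theorem orbitDensity_eq_mul_comp {z : ℝ × ℝ} (hz : 0 < cycleRadicand l m₁ m₃ (z.1 * z.2)) :
    orbitDensity l m₁ m₃ z = 1 / (6 * m₁ * m₃ * √(cycleRadicand l m₁ m₃ (z.1 * z.2))) *
      (1 / √(1 - (1 / (4 * m₁ ^ 2) + 1 / (4 * m₃ ^ 2)) / cycleRadicand l m₁ m₃ (z.1 * z.2) *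
        (z.1 ^ 2 + z.2 ^ 2))) := by
  rw [orbitDensity, one_div_mul_one_div, mul_assoc _ √_, ← Real.sqrt_mul hz.le, mul_one_sub,
    ← mul_assoc, mul_div_cancel₀ _ hz.ne', cycleRadicand]
  congr 3
  ring

theorem orbitPeriod_eq_mul_cosAverage {s : ℝ} (hm₁ : 0 < m₁) (hm₃ : 0 < m₃)
    (hs : 0 < cycleRadicand l m₁ m₃ s) (hs' : 0 < 2 * l * m₃ ^ 2 + s) :
    orbitPeriod l m₁ m₃ s = 1 / (6 * m₁ * m₃ * √(cycleRadicand l m₁ m₃ s)) *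
      cosAverage (fun w => 1 / √(1 - w))
        ((1 / (4 * m₁ ^ 2) + 1 / (4 * m₃ ^ 2)) / cycleRadicand l m₁ m₃ s * s) := by
  set A := cycleRadicand l m₁ m₃ s with hA
  set r := (1 / (4 * m₁ ^ 2) + 1 / (4 * m₃ ^ 2)) / A * s with hr
  have hsum : A * (1 + 2 * r) = (2 * l * m₃ ^ 2 + s) / m₃ ^ 2 := by
    rw [hr]
    field_simp
    rw [hA, cycleRadicand]
    field_simp
    ring
  have hpos : 0 < 1 + 2 * r := pos_of_mul_pos_right (hsum ▸ by positivity) hs.le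
  have hsqrt : √(2 * l * m₃ ^ 2 + s) = m₃ * (√A * √(1 + 2 * r)) := by
    rw [← Real.sqrt_mul hs.le, hsum, Real.sqrt_div hs'.le, Real.sqrt_sq hm₃.le,
      mul_div_cancel₀ _ hm₃.ne']
  have hmodulus : 4 * r / (1 + 2 * r) =
      (m₁ ^ 2 + m₃ ^ 2) * s / (m₁ ^ 2 * (2 * l * m₃ ^ 2 + s)) := by
    rw [← mul_div_mul_left _ _ hs.ne', hsum, hr]
    field_simp
    ring
  rw [cosAverage_one_div_sqrt hpos, hmodulus, orbitPeriod, hsqrt]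
  ring

theorem isHyperbolicAverage_orbitDensity (hl : 0 < l) (hm₁ : 0 < m₁) (hm₃ : 0 < m₃) :
    IsHyperbolicAverage (orbitDensity l m₁ m₃) (orbitPeriod l m₁ m₃) := by
  have hA : AnalyticAt ℝ (cycleRadicand l m₁ m₃) 0 :=
    analyticAt_const.sub (analyticAt_const.mul analyticAt_id)
  have hA_zero : 0 < cycleRadicand l m₁ m₃ 0 := by simpa [cycleRadicand]
  have hA_pos : ∀ᶠ s in 𝓝 (0 : ℝ), 0 < cycleRadicand l m₁ m₃ s :=
    hA.continuousAt.eventually_const_lt hA_zero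
  have hf : AnalyticAt ℝ (fun w : ℝ => 1 / √(1 - w)) 0 :=
    analyticAt_const.div (analyticAt_sqrt_comp (analyticAt_const.sub analyticAt_id) (by simp))
      (by simp)
  have hκ : AnalyticAt ℝ (fun s => 1 / (6 * m₁ * m₃ * √(cycleRadicand l m₁ m₃ s))) 0 :=
    analyticAt_const.div (analyticAt_const.mul (analyticAt_sqrt_comp hA hA_zero.ne'))
      (by positivity)
  have hρ : AnalyticAt ℝ (fun s => (1 / (4 * m₁ ^ 2) + 1 / (4 * m₃ ^ 2)) /
      cycleRadicand l m₁ m₃ s) 0 := analyticAt_const.div hA hA_zero.ne'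
  refine (isHyperbolicAverage_mul_comp hκ hρ hf).congr ?_ ?_
  · filter_upwards [tendsto_fst_mul_snd.eventually hA_pos] with z hz
    exact (orbitDensity_eq_mul_comp hz).symm
  · have hs_pos : ∀ᶠ s in 𝓝 (0 : ℝ), 0 < 2 * l * m₃ ^ 2 + s :=
      (continuous_const_add _).continuousAt.eventually_const_lt (by positivity)
    filter_upwards [hA_pos, hs_pos] with s hs hs'
    exact (orbitPeriod_eq_mul_cosAverage hm₁ hm₃ hs hs').symm

/-- Linear coordinates near `(0, ε √(2 l), 0)` on the sphere, in which the Hamiltonian is, up to a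
constant, the product `x y`. -/
def saddleCoordinates (m₁ m₃ ε : ℝ) : (Fin 3 → ℝ) →L[ℝ] ℝ × ℝ :=
  let p (i : Fin 3) : (Fin 3 → ℝ) →L[ℝ] ℝ := .proj i
  (m₁ • p 0 + (ε * m₃) • p 2).prod (m₁ • p 0 - (ε * m₃) • p 2)

theorem saddleCoordinates_apply (m₁ m₃ ε : ℝ) (p : Fin 3 → ℝ) :
    saddleCoordinates m₁ m₃ ε p = (m₁ * p 0 + ε * m₃ * p 2, m₁ * p 0 - ε * m₃ * p 2) :=
  rfl

theorem hamiltonian_eq_add_mul (h₁ : 1 / I₁ - 1 / I₂ = 2 * m₁ ^ 2)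
    (h₃ : 1 / I₂ - 1 / I₃ = 2 * m₃ ^ 2) (hε : ε ^ 2 = 1) {p : Fin 3 → ℝ} (hp : casimir p = l) :
    hamiltonian I₁ I₂ I₃ p =
      l / I₂ + (saddleCoordinates m₁ m₃ ε p).1 * (saddleCoordinates m₁ m₃ ε p).2 := by
  rw [saddleCoordinates_apply, ← hp, hamiltonian, casimir]
  linear_combination p 0 ^ 2 / 2 * h₁ - p 2 ^ 2 / 2 * h₃ + m₃ ^ 2 * p 2 ^ 2 * hε

theorem orbitDensity_saddleCoordinates (hm₁ : m₁ ≠ 0) (hm₃ : m₃ ≠ 0) (hε : ε ^ 2 = 1)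
    {p : Fin 3 → ℝ} (hp : casimir p = l) (hpos : 0 < ε * p 1) :
    orbitDensity l m₁ m₃ (saddleCoordinates m₁ m₃ ε p) = 1 / (6 * m₁ * m₃ * (ε * p 1)) := by
  have hx : (m₁ * p 0 + ε * m₃ * p 2 + (m₁ * p 0 - ε * m₃ * p 2)) / (2 * m₁) = p 0 := by
    field_simp
    ring
  have hy : (m₁ * p 0 + ε * m₃ * p 2 - (m₁ * p 0 - ε * m₃ * p 2)) / (2 * m₃) = ε * p 2 := by
    field_simp
    ring
  have hradicand : 2 * l - p 0 ^ 2 - (ε * p 2) ^ 2 = (ε * p 1) ^ 2 := by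
    rw [← hp, casimir]
    linear_combination -(p 1 ^ 2 + p 2 ^ 2) * hε
  rw [saddleCoordinates_apply, orbitDensity, hx, hy, hradicand, Real.sqrt_sq hpos.le]

theorem dotProduct_fderiv_eq_zero {ψ : ℝ × ℝ → Fin 3 → ℝ} {z : ℝ × ℝ}
    (hψ : DifferentiableAt ℝ ψ z) (hcas : ∀ᶠ w in 𝓝 z, casimir (ψ w) = l) (v : ℝ × ℝ) :
    ψ z ⬝ᵥ fderiv ℝ ψ z v = 0 := by
  have hcoord (i : Fin 3) : HasFDerivAt (fun w => ψ w i)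
      ((ContinuousLinearMap.proj i).comp (fderiv ℝ ψ z)) z := hasFDerivAt_pi'.1 hψ.hasFDerivAt i
  have hconst := (((hcoord 0).pow 2).add ((hcoord 1).pow 2)).add ((hcoord 2).pow 2)
    |>.unique ((hasFDerivAt_const (2 * l) z).congr_of_eventuallyEq
      (hcas.mono fun w hw => by simp [← hw, casimir, mul_div_cancel₀]))
  have hv := DFunLike.congr_fun hconst v
  simp only [add_apply, smul_apply, ContinuousLinearMap.comp_apply,
    ContinuousLinearMap.proj_apply, zero_apply, pow_one, nsmul_eq_mul, smul_eq_mul,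
    Nat.add_one_sub_one, Nat.cast_ofNat] at hv
  rw [dotProduct, Fin.sum_univ_three]
  linarith

theorem orbitForm_fderiv_eq_det_mul (hm₁ : m₁ ≠ 0) (hm₃ : m₃ ≠ 0) (hε : ε ^ 2 = 1)
    {ψ : ℝ × ℝ → Fin 3 → ℝ} {z : ℝ × ℝ} (hψ : DifferentiableAt ℝ ψ z)
    (hcas : ∀ᶠ w in 𝓝 z, casimir (ψ w) = l) (hpos : 0 < ε * ψ z 1) :
    orbitForm (ψ z) (fderiv ℝ ψ z (1, 0)) (fderiv ℝ ψ z (0, 1)) =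
      (fderiv ℝ (fun w => saddleCoordinates m₁ m₃ ε (ψ w)) z).det *
        orbitDensity l m₁ m₃ (saddleCoordinates m₁ m₃ ε (ψ z)) := by
  have htangent := dotProduct_fderiv_eq_zero hψ hcas
  have hε_ne : ε ≠ 0 := left_ne_zero_of_mul hpos.ne'
  have hψ_ne : ψ z 1 ≠ 0 := right_ne_zero_of_mul hpos.ne'
  have hcomp : fderiv ℝ (fun w => saddleCoordinates m₁ m₃ ε (ψ w)) z =
      (saddleCoordinates m₁ m₃ ε).comp (fderiv ℝ ψ z) :=
    ((saddleCoordinates m₁ m₃ ε).hasFDerivAt.comp z hψ.hasFDerivAt).fderiv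
  rw [orbitForm_eq_dp₃_dp₁ _ _ _ (htangent _) (htangent _) hψ_ne,
    orbitDensity_saddleCoordinates hm₁ hm₃ hε hcas.self_of_nhds hpos, hcomp, det_eq_sub]
  simp only [ContinuousLinearMap.comp_apply, saddleCoordinates_apply]
  field_simp
  ring

theorem eventually_orbitForm_eq_det_mul (hl : 0 < l) (hm₁ : m₁ ≠ 0) (hm₃ : m₃ ≠ 0)
    (hε : ε ^ 2 = 1) {ψ : ℝ × ℝ → Fin 3 → ℝ} (hψ : AnalyticAt ℝ ψ 0)
    (hψ_zero : ψ 0 = ![0, ε * √(2 * l), 0])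
    (hcas : ∀ᶠ z in 𝓝 (0 : ℝ × ℝ), casimir (ψ z) = l) :
    ∀ᶠ z in 𝓝 (0 : ℝ × ℝ), orbitForm (ψ z) (fderiv ℝ ψ z (1, 0)) (fderiv ℝ ψ z (0, 1)) =
      (fderiv ℝ (fun w => saddleCoordinates m₁ m₃ ε (ψ w)) z).det *
        orbitDensity l m₁ m₃ (saddleCoordinates m₁ m₃ ε (ψ z)) := by
  have hpos_zero : 0 < ε * ψ 0 1 := by
    rw [hψ_zero, Matrix.cons_val_one, Matrix.cons_val_zero, ← mul_assoc, ← sq, hε, one_mul]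
    positivity
  have hpos : ∀ᶠ z in 𝓝 (0 : ℝ × ℝ), 0 < ε * ψ z 1 :=
    (continuousAt_const.mul (continuousAt_pi.1 hψ.continuousAt 1)).eventually_const_lt hpos_zero
  filter_upwards [hψ.eventually_analyticAt, hcas.eventually_nhds, hpos] with z hψz hcasz hposz
  exact orbitForm_fderiv_eq_det_mul hm₁ hm₃ hε hψz.differentiableAt hcasz hposz

theorem IsHyperbolicBirkhoffNormalForm.exists_isHyperbolicNormalization (hl : 0 < l)
    (hm₁ : m₁ ≠ 0) (hm₃ : m₃ ≠ 0) (h₁ : 1 / I₁ - 1 / I₂ = 2 * m₁ ^ 2)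
    (h₃ : 1 / I₂ - 1 / I₃ = 2 * m₃ ^ 2) (hε : ε ^ 2 = 1) {𝓗 : ℝ → ℝ}
    (h : IsHyperbolicBirkhoffNormalForm I₁ I₂ I₃ l ![0, ε * √(2 * l), 0] 𝓗) :
    ∃ χ, IsHyperbolicNormalization (orbitDensity l m₁ m₃) (fun t => 𝓗 t - l / I₂) 1 χ := by
  obtain ⟨h𝓗, ψ, hψ, hψ𝓗⟩ := h
  refine ⟨fun z => saddleCoordinates m₁ m₃ ε (ψ z),
    (saddleCoordinates m₁ m₃ ε).analyticAt _ |>.comp hψ.analyticAt, ?_,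
    h𝓗.sub analyticAt_const, ?_, ?_⟩
  · simp [hψ.map_zero, saddleCoordinates_apply]
  · filter_upwards [hψ𝓗, hψ.casimir_eq] with z hz hcas
    rw [← hz, hamiltonian_eq_add_mul h₁ h₃ hε hcas, add_sub_cancel_left]
  · filter_upwards [hψ.pullback_eq, eventually_orbitForm_eq_det_mul hl hm₁ hm₃ hε hψ.analyticAt
      hψ.map_zero hψ.casimir_eq] with z hz hdet
    rw [← hdet, hz]

/-- The inverse of `saddleCoordinates` on the sphere of radius `√(2 l)`. -/
def saddleParametrization (l m₁ m₃ ε : ℝ) (z : ℝ × ℝ) : Fin 3 → ℝ :=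
  ![(z.1 + z.2) / (2 * m₁),
    ε * √(2 * l - ((z.1 + z.2) / (2 * m₁)) ^ 2 - ((z.1 - z.2) / (2 * m₃)) ^ 2),
    ε * ((z.1 - z.2) / (2 * m₃))]

theorem saddleCoordinates_saddleParametrization (hm₁ : m₁ ≠ 0) (hm₃ : m₃ ≠ 0) (hε : ε ^ 2 = 1)
    (z : ℝ × ℝ) : saddleCoordinates m₁ m₃ ε (saddleParametrization l m₁ m₃ ε z) = z := by
  have hy : ε * m₃ * (ε * ((z.1 - z.2) / (2 * m₃))) = (z.1 - z.2) / 2 := by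
    field_simp
    rw [hε, one_mul]
  have hx : m₁ * ((z.1 + z.2) / (2 * m₁)) = (z.1 + z.2) / 2 := by field_simp
  ext <;> simp only [saddleCoordinates_apply, saddleParametrization, Matrix.cons_val, hx, hy] <;>
    ring

theorem eventually_casimir_saddleParametrization (hl : 0 < l) (hε : ε ^ 2 = 1) :
    ∀ᶠ z in 𝓝 (0 : ℝ × ℝ), casimir (saddleParametrization l m₁ m₃ ε z) = l := by
  have hcont : Continuous fun z : ℝ × ℝ =>
      2 * l - ((z.1 + z.2) / (2 * m₁)) ^ 2 - ((z.1 - z.2) / (2 * m₃)) ^ 2 := by fun_prop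
  have hpos : ∀ᶠ z : ℝ × ℝ in 𝓝 0,
      0 < 2 * l - ((z.1 + z.2) / (2 * m₁)) ^ 2 - ((z.1 - z.2) / (2 * m₃)) ^ 2 :=
    hcont.continuousAt.eventually_const_lt (by simpa)
  filter_upwards [hpos] with z hz
  simp only [casimir, saddleParametrization, Matrix.cons_val]
  rw [mul_pow ε, mul_pow ε, hε, Real.sq_sqrt hz.le]
  ring

theorem analyticAt_saddleParametrization (hl : 0 < l) :
    AnalyticAt ℝ (saddleParametrization l m₁ m₃ ε) 0 := by
  have hx : AnalyticAt ℝ (fun z : ℝ × ℝ => (z.1 + z.2) / (2 * m₁)) 0 :=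
    (analyticAt_fst.add analyticAt_snd).div_const
  have hy : AnalyticAt ℝ (fun z : ℝ × ℝ => (z.1 - z.2) / (2 * m₃)) 0 :=
    (analyticAt_fst.sub analyticAt_snd).div_const
  have hsqrt := analyticAt_sqrt_comp ((analyticAt_const (v := 2 * l)).sub (hx.pow 2) |>.sub
    (hy.pow 2)) (by simpa using hl.ne')
  refine analyticAt_pi_iff.2 fun i => ?_
  fin_cases i
  exacts [hx, analyticAt_const.mul hsqrt, analyticAt_const.mul hy]

theorem IsHyperbolicNormalization.isHyperbolicBirkhoffNormalForm (hl : 0 < l)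
    (hm₁ : m₁ ≠ 0) (hm₃ : m₃ ≠ 0) (h₁ : 1 / I₁ - 1 / I₂ = 2 * m₁ ^ 2)
    (h₃ : 1 / I₂ - 1 / I₃ = 2 * m₃ ^ 2) (hε : ε ^ 2 = 1) {E : ℝ → ℝ} {χ : ℝ × ℝ → ℝ × ℝ}
    (h : IsHyperbolicNormalization (orbitDensity l m₁ m₃) E 1 χ) :
    IsHyperbolicBirkhoffNormalForm I₁ I₂ I₃ l ![0, ε * √(2 * l), 0] (fun t => l / I₂ + E t) := by
  have hψ : AnalyticAt ℝ (fun z => saddleParametrization l m₁ m₃ ε (χ z)) 0 :=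
    (analyticAt_saddleParametrization hl).comp_of_eq h.analyticAt h.map_zero
  have hψ_zero : saddleParametrization l m₁ m₃ ε (χ 0) = ![0, ε * √(2 * l), 0] := by
    simp [h.map_zero, saddleParametrization]
  have hcas : ∀ᶠ z in 𝓝 (0 : ℝ × ℝ), casimir (saddleParametrization l m₁ m₃ ε (χ z)) = l :=
    h.tendsto.eventually (eventually_casimir_saddleParametrization hl hε)
  refine ⟨analyticAt_const.add h.analyticAt_profile, _, ⟨hψ, hψ_zero, hcas, ?_⟩, ?_⟩
  · filter_upwards [h.det_mul, eventually_orbitForm_eq_det_mul hl hm₁ hm₃ hε hψ hψ_zero hcas]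
      with z hz hdet
    simpa only [saddleCoordinates_saddleParametrization hm₁ hm₃ hε, hz] using hdet
  · filter_upwards [h.fst_mul_snd, hcas] with z hz hcasz
    rw [hamiltonian_eq_add_mul h₁ h₃ hε hcasz,
      saddleCoordinates_saddleParametrization hm₁ hm₃ hε, hz]

theorem IsHyperbolicNormalization.eventually_hasDerivAt_leftInverse {g : ℝ × ℝ → ℝ}
    {P E Φ : ℝ → ℝ} {χ : ℝ × ℝ → ℝ × ℝ} (h : IsHyperbolicNormalization g E 1 χ)
    (hg : IsHyperbolicAverage g P) (hP : 0 < P 0) (hΦ : ∀ᶠ t in 𝓝 (0 : ℝ), Φ (E t) = t) :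
    ∀ᶠ s in 𝓝 (0 : ℝ), HasDerivAt Φ (SignType.sign (deriv E 0) * P s) s := by
  have hE : deriv E 0 ≠ 0 := (h.deriv_profile_ne_zero one_ne_zero).1
  have hsign : (SignType.sign (deriv E 0) * SignType.sign (deriv E 0) : ℝ) = 1 := by
    rcases hE.lt_or_gt with hneg | hpos
    · simp [sign_neg hneg]
    · simp [sign_pos hpos]
  have hmap : map E (𝓝 0) = 𝓝 0 := by
    rw [h.analyticAt_profile.hasStrictDerivAt.map_nhds_eq hE, h.profile_zero]
  rw [← hmap, eventually_map]
  filter_upwards [h.analyticAt_profile.eventually_analyticAt, hΦ.eventually_nhds,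
    h.deriv_mul_average_eq_sign hg hP] with t ht hΦt hderiv
  have hmul : SignType.sign (deriv E 0) * P (E t) * deriv E t = 1 := by
    rw [mul_assoc, mul_comm (P _), hderiv, hsign]
  rw [eq_inv_of_mul_eq_one_left hmul]
  exact (ht.hasStrictDerivAt.to_local_left_inverse (right_ne_zero_of_mul_eq_one hmul)
    hΦt).hasDerivAt

theorem IsHyperbolicNormalization.eventually_hasDerivAt_inverse (hl : 0 < l) (hm₁ : 0 < m₁)
    (hm₃ : 0 < m₃) {e : ℝ} {𝓗 Φ : ℝ → ℝ} {χ : ℝ × ℝ → ℝ × ℝ}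
    (h : IsHyperbolicNormalization (orbitDensity l m₁ m₃) (fun t => 𝓗 t - e) 1 χ)
    (hΦ : ∀ᶠ t in 𝓝 (0 : ℝ), Φ (𝓗 t) = t) :
    ∀ᶠ x in 𝓝 e,
      HasDerivAt Φ (SignType.sign (deriv 𝓗 0) * orbitPeriod l m₁ m₃ (x - e)) x := by
  have hshift : Tendsto (fun x => x - e) (𝓝 e) (𝓝 0) := by
    simpa using (continuous_sub_right e).tendsto e
  have hderiv := h.eventually_hasDerivAt_leftInverse (Φ := fun s => Φ (s + e))
    (isHyperbolicAverage_orbitDensity hl hm₁ hm₃) (orbitPeriod_zero_pos hl hm₁ hm₃)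
    (by simpa using hΦ)
  filter_upwards [hshift.eventually hderiv] with x hx
  simpa using hx.comp_sub_const x e

end Sphere

open scoped ComplexOrder in
theorem complex_sqrt_ofReal_neg {N : ℝ} (hN : 0 ≤ N) :
    Complex.sqrt ((-N : ℝ) : ℂ) = Complex.I * (√N : ℝ) := by
  have h : (0 : ℂ) ≤ (N : ℂ) := by exact_mod_cast hN
  rw [Complex.ofReal_neg, Complex.sqrt_neg_of_nonneg h, Complex.sqrt_of_nonneg h,
    Complex.ofReal_re]

theorem neg_I_mul_S_eq_orbitPeriod {a b c l m₁ m₃ s : ℝ} (hl : 0 < l) (hm₁ : 0 < m₁)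
    (hm₃ : m₃ ≠ 0) (h₁ : a - b = 2 * m₁ ^ 2) (h₃ : b - c = 2 * m₃ ^ 2)
    (hs : 0 < 2 * l * m₃ ^ 2 + s) :
    -Complex.I * S l b a c (b + s / l) = (orbitPeriod l m₁ m₃ s : ℂ) := by
  set q := 2 * l * m₃ ^ 2 + s with hq
  have hdc : b + s / l - c = q / l := by
    rw [hq]
    field_simp
    linear_combination l * h₃
  have hsqrt : Complex.sqrt (((b + s / l - c) * (b - a) : ℝ) : ℂ) =
      Complex.I * (√(2 / l) * (m₁ * √q) : ℝ) := by
    have hneg : (b + s / l - c) * (b - a) = -(2 / l * (m₁ ^ 2 * q)) := by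
      rw [hdc]
      linear_combination -(q / l) * h₁
    rw [hneg, complex_sqrt_ofReal_neg (by positivity), Real.sqrt_mul (by positivity),
      Real.sqrt_mul (sq_nonneg _), Real.sqrt_sq hm₁.le]
  have hmodulus : (b + s / l - b) * (a - c) / ((b + s / l - c) * (a - b)) =
      (m₁ ^ 2 + m₃ ^ 2) * s / (m₁ ^ 2 * q) := by
    rw [hdc, h₁, show a - c = 2 * m₁ ^ 2 + 2 * m₃ ^ 2 by linear_combination h₁ + h₃]
    field_simp
    ring
  have hroot : (√(2 / l) : ℂ) ≠ 0 := by
    exact_mod_cast (Real.sqrt_pos.2 (by positivity)).ne'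
  rw [S, hsqrt, hmodulus, orbitPeriod, ← hq]
  push_cast
  field_simp

theorem eventually_neg_I_mul_S_eq_orbitPeriod {I₁ I₂ I₃ l m₁ m₃ : ℝ} (hl : 0 < l) (hm₁ : 0 < m₁)
    (hm₃ : m₃ ≠ 0) (h₁ : 1 / I₁ - 1 / I₂ = 2 * m₁ ^ 2) (h₃ : 1 / I₂ - 1 / I₃ = 2 * m₃ ^ 2) :
    ∀ᶠ h in 𝓝 (l / I₂), -Complex.I * S l (1 / I₂) (1 / I₁) (1 / I₃) (h / l) =
      (orbitPeriod l m₁ m₃ (h - l / I₂) : ℂ) := by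
  have hcont : Continuous fun h : ℝ => 2 * l * m₃ ^ 2 + (h - l / I₂) := by fun_prop
  have hpos : ∀ᶠ h in 𝓝 (l / I₂), 0 < 2 * l * m₃ ^ 2 + (h - l / I₂) :=
    hcont.continuousAt.eventually_const_lt (by simp only [sub_self]; positivity)
  filter_upwards [hpos] with h hh
  rw [← neg_I_mul_S_eq_orbitPeriod hl hm₁ hm₃ h₁ h₃ hh]
  congr 2
  field_simp
  ring

theorem exists_pos_eq_two_mul_sq {x : ℝ} (hx : 0 < x) : ∃ m, 0 < m ∧ x = 2 * m ^ 2 :=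
  ⟨√(x / 2), Real.sqrt_pos.2 (half_pos hx), by rw [Real.sq_sqrt (half_pos hx).le]; ring⟩

end FreeRigidBody

end

theorem theorem4p4 (I₁ I₂ I₃ l : ℝ) (hI₁ : 0 < I₁) (hI₁₂ : I₁ < I₂) (hI₂₃ : I₂ < I₃) (hl : 0 < l)
    (P₀ : Fin 3 → ℝ) (hP₀ : P₀ = ![0, √(2 * l), 0] ∨ P₀ = ![0, -√(2 * l), 0]) :
    (∃ 𝓗 : ℝ → ℝ, FreeRigidBody.IsHyperbolicBirkhoffNormalForm I₁ I₂ I₃ l P₀ 𝓗 ∧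
      0 < deriv 𝓗 0) ∧
    ∀ 𝓗 : ℝ → ℝ, FreeRigidBody.IsHyperbolicBirkhoffNormalForm I₁ I₂ I₃ l P₀ 𝓗 →
      𝓗 0 = l / I₂ ∧ deriv 𝓗 0 ≠ 0 ∧
      ∀ Φ : ℝ → ℝ, (∀ᶠ t in 𝓝 (0 : ℝ), Φ (𝓗 t) = t) →
        ∀ᶠ h in 𝓝 (l / I₂),
          let a : ℝ := 1 / I₁
          let b : ℝ := 1 / I₂
          let c : ℝ := 1 / I₃
          let d : ℝ := h / l
          let value : ℂ := Complex.I / (3 * (Real.pi : ℂ)) * (√(2 / l) : ℝ) *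
            (1 / Complex.sqrt (((d - c) * (b - a) : ℝ) : ℂ)) *
            (FreeRigidBody.ellipticK ((d - b) * (a - c) / ((d - c) * (a - b))) : ℝ)
          HasDerivAt (fun x : ℝ => (Φ x : ℂ)) (((SignType.sign (deriv 𝓗 0) : ℝ) : ℂ) * value) h ∧
            value = -Complex.I * FreeRigidBody.S l b a c d := by
  obtain ⟨m₁, hm₁, h₁⟩ := FreeRigidBody.exists_pos_eq_two_mul_sq
    (sub_pos.2 (one_div_lt_one_div_of_lt hI₁ hI₁₂))
  obtain ⟨m₃, hm₃, h₃⟩ := FreeRigidBody.exists_pos_eq_two_mul_sq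
    (sub_pos.2 (one_div_lt_one_div_of_lt (hI₁.trans hI₁₂) hI₂₃))
  obtain ⟨ε, hε, rfl⟩ : ∃ ε : ℝ, ε ^ 2 = 1 ∧ P₀ = ![0, ε * √(2 * l), 0] := by
    rcases hP₀ with rfl | rfl
    exacts [⟨1, by norm_num, by simp⟩, ⟨-1, by norm_num, by simp⟩]
  constructor
  · obtain ⟨E, χ, hE, hE_pos⟩ :=
      (FreeRigidBody.isHyperbolicAverage_orbitDensity hl hm₁ hm₃).exists_isHyperbolicNormalization
        (FreeRigidBody.orbitPeriod_zero_pos hl hm₁ hm₃)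
    exact ⟨_, hE.isHyperbolicBirkhoffNormalForm hl hm₁.ne' hm₃.ne' h₁ h₃ hε, by simpa⟩
  intro 𝓗 h𝓗
  obtain ⟨χ, hχ⟩ := h𝓗.exists_isHyperbolicNormalization hl hm₁.ne' hm₃.ne' h₁ h₃ hε
  refine ⟨sub_eq_zero.1 hχ.profile_zero, by simpa using (hχ.deriv_profile_ne_zero one_ne_zero).1,
    fun Φ hΦ => ?_⟩
  filter_upwards [hχ.eventually_hasDerivAt_inverse hl hm₁ hm₃ hΦ,
    FreeRigidBody.eventually_neg_I_mul_S_eq_orbitPeriod hl hm₁ hm₃.ne' h₁ h₃] with x hx hS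
  intro a b c d value
  have hvalue : value = -Complex.I * FreeRigidBody.S l b a c d := by
    simp only [value, FreeRigidBody.S]
    ring
  refine ⟨?_, hvalue⟩
  rw [hvalue, hS]
  simpa using hx.ofReal_comp
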